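/- Let $1\le n<m$ and let $A\in\mathbb R^{n\times m}$ have linearly independent rows and spectral norm $\|A\|_2\le 1$ (for instance, let the rows of $A$ be orthonormal, so that $\|A\|_2=1$). Write $\|s\|$ for the Euclidean norm and $\|s\|_0$ for the number of nonzero entries of $s\in\mathbb R^m$. *Definitions.* The lower asymmetric restricted isometry constant $\delta_r^{\min}$ of $A$ is the smallest $\delta\ge 0$ with $(1-\delta)\|s\|^2\le\|As\|^2$ for all $s$ with $\|s\|_0\le r$. Let $$\gamma_A(r)=\sup\Big\{\tfrac{\sum_{i\in I}s_i^2}{\sum_{i\notin I}s_i^2}\;:\;|I|\le r,\ As=0,\ s\ne 0\Big\}\in[0,\infty].$$ For real $\gamma\ge 0$ let $f_\gamma(u)=1-u^2/(1+\gamma)$ if $|u|\le1$, $f_\gamma(u)=(|u|-\gamma-1)^2/(\gamma^2+\gamma)$ if $1<|u|\le 1+\gamma$, $f_\gamma(u)=0$ if $|u|>1+\gamma$, and let $F_{\gamma,\sigma}(s)=\sum_{i=1}^m f_\gamma(s_i/\sigma)$ for $\sigma>0$. Given $x\in\mathbb R^n$ and scales $\sigma_1,\sigma_2,\dots$, *asymptotic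 SL0* (step size $\mu\to0$, number of inner iterations $L\to\infty$) starts from the minimum norm solution $s_1=A^T(AA^T)^{-1}x$ of $As=x$; for $j\ge2$, $s_j=\lim_{t\to\infty}a(t)$, where $a$ is the steepest ascent trajectory $\dot a=P\,\nabla F_{\gamma,\sigma_j}(a)$, $a(0)=s_{j-1}$, and $P$ is the orthogonal projection onto $\{s:As=0\}$. *Claim.* Let $\alpha>1$, let $k\ge 0$ be an integer, put $n_0=\lceil 2k\alpha\rceil$, and suppose that $$\alpha\,\delta^{\min}_{n_0}+\|A\|_2\le\alpha .$$ Then $\gamma:=\gamma_A(n_0)$ is finite, and there is $c_0\in(0,1)$ such that for all $x$ and all $s_0$ with $As_0=x$ and $\|s_0\|_0=k$ the following hold. 1. $s_0$ is the unique sparsest solution: every other solution $s$ of $As=x$ has $\|s\|_0>k$. 2. For every $c\in[c_0,1)$ and every $\sigma_1>0$ with $\|A^T(AA^T)^{-1}x\|\le\sigma_1\sqrt{k(1+\gamma)}$, asymptotic SL0 with spline parameter $\gamma$ and scales $\sigma_j=\sigma_1c^{\,j-1}$ is well defined (at every step $j\ge2$ the trajectory exists and every such trajectory converges to $s_j$),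 each $s_j$ with $j\ge 2$ maximizes $F_{\gamma,\sigma_j}$ on $\{s: As=x\}$, and $\lim_{j\to\infty}s_j=s_0$. Moreover, if $k<n_0/(2+2\gamma)$, then $c_0$ can be chosen with $c_0\le \dfrac{2m}{2m+n_0/(2+2\gamma)-k}$, so that this value of $c$ is admissible. -/

import Mathlib

open Filter Topology
open scoped Matrix.Norms.L2Operator

noncomputable section

namespace SL0

/-- Number of nonzero entries of a vector (the "`ℓ⁰` norm"). -/
def nnz {m : ℕ} (s : EuclideanSpace ℝ (Fin m)) : ℕ :=
  (Finset.univ.filter fun i => s i ≠ 0).card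

/-- The matrix `A` as a linear map between Euclidean spaces. -/
def toLin {n m : ℕ} (A : Matrix (Fin n) (Fin m) ℝ) :
    EuclideanSpace ℝ (Fin m) →ₗ[ℝ] EuclideanSpace ℝ (Fin n) :=
  Matrix.toEuclideanLin A

/-- The lower asymmetric restricted isometry constant `δ_r^min` of `A`: the smallest nonnegative
`δ` with `(1 - δ) ‖s‖² ≤ ‖A s‖²` for all `s` with at most `r` nonzero entries. -/
def lowerARIC {n m : ℕ} (A : Matrix (Fin n) (Fin m) ℝ) (r : ℕ) : ℝ :=
  sInf {δ : ℝ | 0 ≤ δ ∧ ∀ s : EuclideanSpace ℝ (Fin m), nnz s ≤ r →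
    (1 - δ) * ‖s‖ ^ 2 ≤ ‖toLin A s‖ ^ 2}

/-- The infimum defining `lowerARIC` is attained. -/
theorem lowerARIC_isLeast {n m : ℕ} (A : Matrix (Fin n) (Fin m) ℝ) (r : ℕ) :
    IsLeast {δ : ℝ | 0 ≤ δ ∧ ∀ s : EuclideanSpace ℝ (Fin m), nnz s ≤ r →
      (1 - δ) * ‖s‖ ^ 2 ≤ ‖toLin A s‖ ^ 2} (lowerARIC A r) := by
  have hne : {δ : ℝ | 0 ≤ δ ∧ ∀ s : EuclideanSpace ℝ (Fin m), nnz s ≤ r →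
      (1 - δ) * ‖s‖ ^ 2 ≤ ‖toLin A s‖ ^ 2}.Nonempty :=
    ⟨1, zero_le_one, fun s _ => by simp⟩
  refine IsClosed.isLeast_csInf ?_ hne ⟨0, fun δ h => h.1⟩
  have : {δ : ℝ | 0 ≤ δ ∧ ∀ s : EuclideanSpace ℝ (Fin m), nnz s ≤ r →
      (1 - δ) * ‖s‖ ^ 2 ≤ ‖toLin A s‖ ^ 2} =
      Set.Ici 0 ∩ ⋂ (s : EuclideanSpace ℝ (Fin m)) (_ : nnz s ≤ r),
        {δ : ℝ | (1 - δ) * ‖s‖ ^ 2 ≤ ‖toLin A s‖ ^ 2} := by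
    ext δ; simp
  rw [this]
  refine isClosed_Ici.inter (isClosed_iInter fun s => isClosed_iInter fun _ => ?_)
  exact isClosed_le (by fun_prop) continuous_const

/-- `γ_A(r)`: the supremum of `‖s_I‖² / ‖s_{Iᶜ}‖²` over index sets `I` with `|I| ≤ r` and nonzero
`s` in the null space of `A`. It is `∞` as soon as some such `s` vanishes outside some such `I`. -/
def nullRatio {n m : ℕ} (A : Matrix (Fin n) (Fin m) ℝ) (r : ℕ) : ENNReal :=
  ⨆ (I : Finset (Fin m)) (_ : I.card ≤ r) (s : EuclideanSpace ℝ (Fin m))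
    (_ : toLin A s = 0) (_ : s ≠ 0),
    ENNReal.ofReal (∑ i ∈ I, s i ^ 2) / ENNReal.ofReal (∑ i ∈ Iᶜ, s i ^ 2)

/-- The quadratic spline `f_γ` with knots `±1`, `±(1 + γ)`. -/
def spline (γ u : ℝ) : ℝ :=
  if |u| ≤ 1 then 1 - u ^ 2 / (1 + γ)
  else if |u| ≤ 1 + γ then (|u| - γ - 1) ^ 2 / (γ ^ 2 + γ)
  else 0

/-- The cost function `F_{γ,σ}(s) = ∑ᵢ f_γ(sᵢ / σ)`. -/
def cost {m : ℕ} (γ σ : ℝ) (s : EuclideanSpace ℝ (Fin m)) : ℝ :=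
  ∑ i, spline γ (s i / σ)

/-- The minimum `ℓ²` norm solution `Aᵀ (A Aᵀ)⁻¹ x` of `A s = x` (for `A` of full row rank). -/
def minNormSol {n m : ℕ} (A : Matrix (Fin n) (Fin m) ℝ) (x : EuclideanSpace ℝ (Fin n)) :
    EuclideanSpace ℝ (Fin m) :=
  toLin (A.transpose * (A * A.transpose)⁻¹) x

/-- `a : [0, ∞) → ℝᵐ` is the steepest ascent trajectory of `F` from `p` inside the affine space
`{s | A s = A p}`: it solves `a' = P ∇F(a)`, `a(0) = p`, where `P` is the orthogonal projection
onto the null space of `A`, so that `P ∇F` is the gradient of the restriction of `F`. -/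
def IsSteepestAscent {n m : ℕ} (A : Matrix (Fin n) (Fin m) ℝ)
    (F : EuclideanSpace ℝ (Fin m) → ℝ) (p : EuclideanSpace ℝ (Fin m))
    (a : ℝ → EuclideanSpace ℝ (Fin m)) : Prop :=
  a 0 = p ∧ ∀ t : ℝ, 0 ≤ t →
    HasDerivWithinAt a ((LinearMap.ker (toLin A)).starProjection (gradient F (a t)))
      (Set.Ici 0) t

/-- `s 0, s 1, …` are the outer iterates of asymptotic SL0 for the system `A s = x`, with spline
parameter `γ` and scales `σ 0, σ 1, …`: the start is the minimum norm solution, and at every later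
scale the steepest ascent trajectory of the cost function started at the previous iterate exists
and converges, as time tends to infinity, to the next iterate. -/
def IsAsymptoticSL0 {n m : ℕ} (A : Matrix (Fin n) (Fin m) ℝ) (x : EuclideanSpace ℝ (Fin n))
    (γ : ℝ) (σ : ℕ → ℝ) (s : ℕ → EuclideanSpace ℝ (Fin m)) : Prop :=
  s 0 = minNormSol A x ∧ ∀ j : ℕ,
    (∃ a, IsSteepestAscent A (cost γ (σ (j + 1))) (s j) a) ∧
    ∀ a, IsSteepestAscent A (cost γ (σ (j + 1))) (s j) a → Tendsto a atTop (𝓝 (s (j + 1)))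

end SL0

end

noncomputable section

namespace SL0

/-! ### The quadratic spline -/

/-! Write K for the null space of A and N for n₀. Splitting v in K into its part on I and the rest,
the restricted isometry hypothesis gives ∑_I v² ≤ α ∑_{Iᶜ} v² for |I| ≤ N, so γ ≤ α is finite and is
itself such a constant. The spline is matched to γ: its second derivative is -2/(1+γ) on |u| < 1 and
never exceeds 2/(γ²+γ), which is 1/γ times as large in absolute value. Along K the cost is therefore
strictly concave wherever fewer than N entries exceed 1 (`IsCrit.cost_lt`). An entry of size at
least 1 loses at least 1/(1+γ) of the maximal value m, so this holds above the level m - N/(1+γ)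
(`card_large_lt`).

Local strict concavity does not yet give one critical point per coset, since a superlevel set could
have several components. A homotopy settles this (`IsCrit.eq_of_lt_cost`): two high critical points
on z + K are followed along t • z + K as t decreases to 0. They persist, because shrinking raises
the cost, and they cannot merge, by strict concavity; but on K itself only 0 is a high critical
point. High superlevel sets in a coset are compact, so steepest ascent from a high level converges
to the maximizer (`exists_isMaxOn_tendsto`).

For the outer loop, a maximizer has cost at least that of s₀, hence at least m - k. Replacing σ by
cσ costs at most 2m(1/c - 1), and N/(1+γ) > k because N ≥ 2kα and 2α > 1+γ; for c near 1 the next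
ascent therefore starts high enough. Finally, cost at least m - k leaves at most k entries above
(1+γ)σ. These and the support of s₀ are at most 2k ≤ N indices, so the null space inequality bounds
‖s - s₀‖ by a multiple of σ (`norm_sub_sq_le_of_le_cost`). -/

/-- The derivative of `x ↦ (max x 0) ^ 2`. -/
theorem hasDerivAt_posPart_sq (x : ℝ) :
    HasDerivAt (fun y : ℝ => (max y 0) ^ 2) (2 * max x 0) x := by
  rcases lt_trichotomy x 0 with h | h | h
  · rw [max_eq_right h.le, mul_zero]
    refine (hasDerivAt_const x (0 : ℝ)).congr_of_eventuallyEq ?_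
    filter_upwards [Iio_mem_nhds h] with y hy
    simp [max_eq_right (le_of_lt (Set.mem_Iio.1 hy))]
  · subst h
    rw [max_self, mul_zero, hasDerivAt_iff_isLittleO]
    simp only [max_self, ne_eq, OfNat.ofNat_ne_zero, not_false_eq_true, zero_pow, sub_zero,
      smul_zero]
    refine Asymptotics.IsBigO.trans_isLittleO (Asymptotics.IsBigO.of_bound 1 ?_)
      (Asymptotics.isLittleO_pow_id one_lt_two)
    refine Eventually.of_forall fun y => ?_
    rw [one_mul, Real.norm_eq_abs, Real.norm_eq_abs, abs_pow, abs_pow, abs_of_nonneg (le_max_right y 0)]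
    exact pow_le_pow_left₀ (le_max_right y 0) (max_le (le_abs_self y) (abs_nonneg y)) 2
  · rw [max_eq_left h.le]
    have : HasDerivAt (fun y : ℝ => y ^ 2) (2 * x) x := by
      simpa using hasDerivAt_pow 2 x
    refine this.congr_of_eventuallyEq ?_
    filter_upwards [Ioi_mem_nhds h] with y hy
    rw [max_eq_left (le_of_lt (Set.mem_Ioi.1 hy))]

/-- The derivative of the spline, for `γ > 0`. -/
def splineDeriv (γ u : ℝ) : ℝ :=
  -(2 * u / (1 + γ)) + 2 / γ * (max (u - 1) 0 - max (-u - 1) 0)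
    - 2 / (γ ^ 2 + γ) * (max (u - 1 - γ) 0 - max (-u - 1 - γ) 0)

/-- Each change of curvature at a knot is a multiple of a squared positive part, so one formula
replaces the cases, and differentiability at the knots needs no gluing. -/
theorem spline_eq {γ : ℝ} (hγ : 0 < γ) (u : ℝ) :
    spline γ u = 1 - u ^ 2 / (1 + γ) + 1 / γ * ((max (u - 1) 0) ^ 2 + (max (-u - 1) 0) ^ 2)
      - 1 / (γ ^ 2 + γ) * ((max (u - 1 - γ) 0) ^ 2 + (max (-u - 1 - γ) 0) ^ 2) := by
  have h1 : γ ^ 2 + γ ≠ 0 := by positivity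
  have h2 : 1 + γ ≠ 0 := by positivity
  unfold spline
  rcases le_total 0 u with hu | hu
  · rw [abs_of_nonneg hu, max_eq_right (by linarith : -u - 1 ≤ 0),
      max_eq_right (by linarith : -u - 1 - γ ≤ 0)]
    split_ifs with h h'
    · rw [max_eq_right (by linarith), max_eq_right (by linarith)]; simp
    · rw [max_eq_left (by linarith), max_eq_right (by linarith)]; field_simp; ring
    · rw [max_eq_left (by linarith), max_eq_left (by linarith)]; field_simp; ring
  · rw [abs_of_nonpos hu, max_eq_right (by linarith : u - 1 ≤ 0),
      max_eq_right (by linarith : u - 1 - γ ≤ 0)]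
    split_ifs with h h'
    · rw [max_eq_right (by linarith), max_eq_right (by linarith)]; simp
    · rw [max_eq_left (by linarith), max_eq_right (by linarith)]; field_simp; ring
    · rw [max_eq_left (by linarith), max_eq_left (by linarith)]; field_simp; ring

theorem hasDerivAt_spline {γ : ℝ} (hγ : 0 < γ) (u : ℝ) :
    HasDerivAt (spline γ) (splineDeriv γ u) u := by
  rw [funext (spline_eq hγ)]
  have key : ∀ (a b : ℝ), HasDerivAt (fun y : ℝ => (max (a * y - b) 0) ^ 2)
      (2 * max (a * u - b) 0 * a) u := fun a b => by
    have h := (hasDerivAt_posPart_sq (a * u - b)).comp u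
      (((hasDerivAt_id u).const_mul a).sub_const b)
    simpa [Function.comp_def] using h
  have e1 := key 1 1
  have e2 := key (-1) 1
  have e3 := key 1 (1 + γ)
  have e4 := key (-1) (1 + γ)
  have e0 : HasDerivAt (fun y : ℝ => y ^ 2) (2 * u) u := by simpa using hasDerivAt_pow 2 u
  have h := (((hasDerivAt_const u (1 : ℝ)).sub (e0.div_const (1 + γ))).add
    ((e1.add e2).const_mul (1 / γ))).sub ((e3.add e4).const_mul (1 / (γ ^ 2 + γ)))
  refine (h.congr_deriv ?_).congr_of_eventuallyEq (Eventually.of_forall fun y => ?_)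
  · simp only [splineDeriv, sub_sub, one_mul, neg_mul]
    ring
  · simp only [Pi.add_apply, Pi.sub_apply, sub_sub, one_mul, neg_mul]

theorem splineDeriv_neg (γ u : ℝ) : splineDeriv γ (-u) = -splineDeriv γ u := by
  unfold splineDeriv; simp; ring

theorem splineDeriv_of_abs_le_one {γ u : ℝ} (hγ : 0 < γ) (hu : |u| ≤ 1) :
    splineDeriv γ u = -(2 * u / (1 + γ)) := by
  obtain ⟨h1, h2⟩ := abs_le.1 hu
  unfold splineDeriv
  rw [max_eq_right (by linarith), max_eq_right (by linarith), max_eq_right (by linarith),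
    max_eq_right (by linarith)]
  simp

theorem splineDeriv_of_mem_Icc {γ u : ℝ} (hγ : 0 < γ) (hu : u ∈ Set.Icc 1 (1 + γ)) :
    splineDeriv γ u = 2 * (u - γ - 1) / (γ ^ 2 + γ) := by
  obtain ⟨h1, h2⟩ := hu
  have h3 : γ ^ 2 + γ ≠ 0 := by positivity
  have h4 : 1 + γ ≠ 0 := by positivity
  unfold splineDeriv
  rw [max_eq_left (by linarith), max_eq_right (by linarith), max_eq_right (by linarith),
    max_eq_right (by linarith)]
  field_simp
  ring

theorem splineDeriv_of_ge {γ u : ℝ} (hγ : 0 < γ) (hu : 1 + γ ≤ u) : splineDeriv γ u = 0 := by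
  have h3 : γ ^ 2 + γ ≠ 0 := by positivity
  have h4 : 1 + γ ≠ 0 := by positivity
  unfold splineDeriv
  rw [max_eq_left (by linarith), max_eq_right (by linarith), max_eq_left (by linarith),
    max_eq_right (by linarith)]
  field_simp
  ring

/-- The upper bound makes the spline decrease in |u|; the lower bound limits the loss when the
argument is scaled up. -/
theorem splineDeriv_mul_self_mem {γ : ℝ} (hγ : 0 < γ) (u : ℝ) :
    splineDeriv γ u * u ∈ Set.Icc (-2) 0 := by
  wlog hu : 0 ≤ u generalizing u
  · have := this (-u) (by linarith)
    rwa [splineDeriv_neg, neg_mul_neg] at this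
  rcases le_total u 1 with h1 | h1
  · rw [splineDeriv_of_abs_le_one hγ (by rwa [abs_of_nonneg hu])]
    constructor
    · rw [neg_mul, neg_le_neg_iff, div_mul_eq_mul_div, div_le_iff₀ (by positivity)]
      nlinarith
    · rw [neg_mul]; exact neg_nonpos.2 (by positivity)
  rcases le_total u (1 + γ) with h2 | h2
  · rw [splineDeriv_of_mem_Icc hγ ⟨h1, h2⟩, div_mul_eq_mul_div]
    constructor
    · rw [le_div_iff₀ (by positivity)]
      nlinarith
    · exact div_nonpos_of_nonpos_of_nonneg (by nlinarith) (by positivity)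
  · rw [splineDeriv_of_ge hγ h2]; simp

theorem abs_splineDeriv_le {γ : ℝ} (hγ : 0 < γ) (u : ℝ) : |splineDeriv γ u| ≤ 2 := by
  rcases le_total |u| 1 with h | h
  · rw [splineDeriv_of_abs_le_one hγ h, abs_neg, abs_div, abs_mul, abs_of_pos (by linarith : 0 < 1 + γ),
      div_le_iff₀ (by positivity), abs_two]
    nlinarith
  · have h1 := splineDeriv_mul_self_mem hγ u
    have h2 : |splineDeriv γ u| * |u| ≤ 2 := by
      rw [← abs_mul]; exact abs_le.2 ⟨h1.1, h1.2.trans zero_le_two⟩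
    nlinarith [abs_nonneg (splineDeriv γ u)]

theorem continuous_splineDeriv (γ : ℝ) : Continuous (splineDeriv γ) := by
  unfold splineDeriv; fun_prop

theorem exists_lipschitzWith_splineDeriv (γ : ℝ) :
    ∃ C : NNReal, LipschitzWith C (splineDeriv γ) := by
  have key : ∀ (a b : ℝ), ∃ C : NNReal, LipschitzWith C (fun u : ℝ => max (a * u - b) 0) :=
    fun a b => ⟨‖a‖₊, by
      refine LipschitzWith.max_const ?_ 0
      refine LipschitzWith.of_dist_le_mul fun x y => ?_
      rw [Real.dist_eq, Real.dist_eq, coe_nnnorm, Real.norm_eq_abs, ← abs_mul]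
      exact le_of_eq (congrArg _ (by ring))⟩
  have hsm : ∀ (f : ℝ → ℝ) (a : ℝ), (∃ C : NNReal, LipschitzWith C f) →
      ∃ C : NNReal, LipschitzWith C (fun u => a * f u) := fun f a ⟨C, hC⟩ =>
    ⟨‖a‖₊ * C, by
      refine LipschitzWith.of_dist_le_mul fun x y => ?_
      have := hC.dist_le_mul x y
      rw [Real.dist_eq] at this ⊢
      rw [← mul_sub, abs_mul, NNReal.coe_mul, coe_nnnorm, Real.norm_eq_abs, mul_assoc]
      exact mul_le_mul_of_nonneg_left this (abs_nonneg _)⟩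
  obtain ⟨C1, h1⟩ := key 1 1
  obtain ⟨C2, h2⟩ := key (-1) 1
  obtain ⟨C3, h3⟩ := key 1 (1 + γ)
  obtain ⟨C4, h4⟩ := key (-1) (1 + γ)
  obtain ⟨C5, h5⟩ := hsm _ (-(2 / (1 + γ))) ⟨1, LipschitzWith.id⟩
  obtain ⟨C6, h6⟩ := hsm _ (2 / γ) ⟨_, h1.sub h2⟩
  obtain ⟨C7, h7⟩ := hsm _ (2 / (γ ^ 2 + γ)) ⟨_, h3.sub h4⟩
  have e : splineDeriv γ = fun u => -(2 / (1 + γ)) * id u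
      + 2 / γ * (max (1 * u - 1) 0 - max (-1 * u - 1) 0)
      - 2 / (γ ^ 2 + γ) * (max (1 * u - (1 + γ)) 0 - max (-1 * u - (1 + γ)) 0) := by
    funext u
    simp only [splineDeriv, sub_sub, one_mul, neg_mul, id]
    ring
  rw [e]
  exact ⟨_, (h5.add h6).sub h7⟩

/-! ### Monotonicity, levels and curvature of the spline. -/

theorem spline_abs (γ u : ℝ) : spline γ |u| = spline γ u := by
  simp [spline]

theorem spline_zero (γ : ℝ) : spline γ 0 = 1 := by
  simp [spline]

theorem spline_nonneg {γ : ℝ} (hγ : 0 ≤ γ) (u : ℝ) : 0 ≤ spline γ u := by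
  unfold spline
  split_ifs with h
  · have : u ^ 2 ≤ 1 := (sq_le_one_iff_abs_le_one u).2 h
    rw [sub_nonneg, div_le_one (by linarith)]
    linarith
  · positivity
  · exact le_rfl

theorem antitoneOn_spline {γ : ℝ} (hγ : 0 ≤ γ) : AntitoneOn (spline γ) (Set.Ici 0) := by
  intro u hu w hw huw
  simp only [Set.mem_Ici] at hu hw
  rcases hγ.eq_or_lt with rfl | hγ
  · unfold spline
    rw [abs_of_nonneg hu, abs_of_nonneg hw]
    split_ifs <;> simp only [add_zero, div_one] at * <;> nlinarith
  · refine antitoneOn_of_deriv_nonpos (convex_Ici 0)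
      (fun x _ => (hasDerivAt_spline hγ x).continuousAt.continuousWithinAt)
      (fun x _ => (hasDerivAt_spline hγ x).differentiableAt.differentiableWithinAt) ?_ hu hw huw
    intro x hx
    rw [interior_Ici, Set.mem_Ioi] at hx
    rw [(hasDerivAt_spline hγ x).deriv]
    by_contra! h
    exact absurd (splineDeriv_mul_self_mem hγ x).2 (not_le.2 (mul_pos h hx))

theorem spline_le_spline {γ u w : ℝ} (hγ : 0 ≤ γ) (h : |u| ≤ |w|) : spline γ w ≤ spline γ u := by
  rw [← spline_abs γ u, ← spline_abs γ w]
  exact antitoneOn_spline hγ (abs_nonneg u) (abs_nonneg w) h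

theorem spline_le_one {γ : ℝ} (hγ : 0 ≤ γ) (u : ℝ) : spline γ u ≤ 1 := by
  rw [← spline_zero γ]
  exact spline_le_spline hγ (by simp)

theorem spline_le_of_one_le_abs {γ u : ℝ} (hγ : 0 ≤ γ) (hu : 1 ≤ |u|) :
    spline γ u ≤ 1 - 1 / (1 + γ) := by
  have : spline γ 1 = 1 - 1 / (1 + γ) := by simp [spline]
  rw [← this]
  exact spline_le_spline hγ (by simpa using hu)

/-- The central parabola continued to all of ℝ stays below the spline; on the outer pieces the
difference is a positive multiple of (|u| - 1)². It turns a bound on the Euclidean norm into a lower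
bound on the cost. -/
theorem one_sub_le_spline {γ : ℝ} (hγ : 0 < γ) (u : ℝ) : 1 - u ^ 2 / (1 + γ) ≤ spline γ u := by
  unfold spline
  split_ifs with h h'
  · exact le_rfl
  · push Not at h
    rw [one_sub_div (by positivity), div_le_div_iff₀ (by positivity) (by positivity), ← sq_abs u]
    nlinarith [mul_nonneg (mul_nonneg (by positivity : 0 ≤ (1 + γ)) (by positivity : 0 ≤ (1 + γ)))
      (sq_nonneg (|u| - 1))]
  · push Not at h'
    rw [sub_nonpos, one_le_div (by positivity), ← sq_abs u]
    nlinarith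

/-- The spline is `2 / (γ² + γ)`-semiconvex from above. -/
theorem spline_le_quadratic {γ : ℝ} (hγ : 0 < γ) (u w : ℝ) :
    spline γ w ≤ spline γ u + splineDeriv γ u * (w - u) + (w - u) ^ 2 / (γ ^ 2 + γ) := by
  have tangent : ∀ a b : ℝ, (max a 0) ^ 2 + 2 * max a 0 * (b - a) ≤ (max b 0) ^ 2 := fun a b => by
    rcases le_total a 0 with ha | ha <;> rcases le_total b 0 with hb | hb <;>
      simp only [max_eq_left, max_eq_right, ha, hb] <;> nlinarith [sq_nonneg (a - b)]
  -- The right side is the Huber function, the supremum over |y| ≤ 1 of the affine functions 2vy -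
  -- y², hence convex. At u the supremum is attained at the clamp of u to [-1, 1], which is the y
  -- set below.
  have huber : ∀ v y : ℝ, |y| ≤ 1 →
      2 * v * y - y ^ 2 ≤ v ^ 2 - ((max (v - 1) 0) ^ 2 + (max (-v - 1) 0) ^ 2) := fun v y hy => by
    obtain ⟨h1, h2⟩ := abs_le.1 hy
    rcases le_total (v - 1) 0 with ha | ha <;> rcases le_total (-v - 1) 0 with hb | hb <;>
      simp only [max_eq_left, max_eq_right, ha, hb] <;> nlinarith [sq_nonneg (v - y)]
  set y := u - max (u - 1) 0 + max (-u - 1) 0 with hy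
  have hy1 : |y| ≤ 1 := by
    rw [abs_le]
    rcases le_total (u - 1) 0 with ha | ha <;> rcases le_total (-u - 1) 0 with hb | hb <;>
      simp only [max_eq_left, max_eq_right, ha, hb] at hy <;> constructor <;> linarith
  have hu : u ^ 2 - ((max (u - 1) 0) ^ 2 + (max (-u - 1) 0) ^ 2) = 2 * u * y - y ^ 2 := by
    rcases le_total (u - 1) 0 with ha | ha <;> rcases le_total (-u - 1) 0 with hb | hb <;>
      simp only [max_eq_left, max_eq_right, ha, hb] at hy ⊢ <;> rw [hy] <;> nlinarith
  have hw := huber w y hy1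
  have t1 := tangent (u - 1 - γ) (w - 1 - γ)
  have t2 := tangent (-u - 1 - γ) (-w - 1 - γ)
  have hc : 0 < γ ^ 2 + γ := by positivity
  have h2 : 1 + γ ≠ 0 := by positivity
  rw [spline_eq hγ, spline_eq hγ, splineDeriv, ← sub_nonneg]
  -- The remainder is a positive combination of the gaps between two kinds of convex functions
  -- (Huber, squared positive parts) and their tangents at u, since 1/(1+γ) + 1/(γ²+γ) = 1/γ.
  have e : (1 - u ^ 2 / (1 + γ) + 1 / γ * ((max (u - 1) 0) ^ 2 + (max (-u - 1) 0) ^ 2)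
      - 1 / (γ ^ 2 + γ) * ((max (u - 1 - γ) 0) ^ 2 + (max (-u - 1 - γ) 0) ^ 2)
      + (-(2 * u / (1 + γ)) + 2 / γ * (max (u - 1) 0 - max (-u - 1) 0)
        - 2 / (γ ^ 2 + γ) * (max (u - 1 - γ) 0 - max (-u - 1 - γ) 0)) * (w - u)
      + (w - u) ^ 2 / (γ ^ 2 + γ))
      - (1 - w ^ 2 / (1 + γ) + 1 / γ * ((max (w - 1) 0) ^ 2 + (max (-w - 1) 0) ^ 2)
      - 1 / (γ ^ 2 + γ) * ((max (w - 1 - γ) 0) ^ 2 + (max (-w - 1 - γ) 0) ^ 2))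
      = 1 / γ * ((w ^ 2 - ((max (w - 1) 0) ^ 2 + (max (-w - 1) 0) ^ 2))
          - (u ^ 2 - ((max (u - 1) 0) ^ 2 + (max (-u - 1) 0) ^ 2)) - 2 * y * (w - u))
        + 1 / (γ ^ 2 + γ) * (((max (w - 1 - γ) 0) ^ 2 -
            ((max (u - 1 - γ) 0) ^ 2 + 2 * max (u - 1 - γ) 0 * ((w - 1 - γ) - (u - 1 - γ))))
          + ((max (-w - 1 - γ) 0) ^ 2 - ((max (-u - 1 - γ) 0) ^ 2 +
            2 * max (-u - 1 - γ) 0 * ((-w - 1 - γ) - (-u - 1 - γ))))) := by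
    rw [hy]
    field_simp
    ring
  rw [e, hu]
  have a1 : 0 ≤ 2 * w * y - y ^ 2 - (2 * u * y - y ^ 2) - 2 * y * (w - u) := by
    apply le_of_eq; ring
  refine add_nonneg (mul_nonneg (by positivity) (by linarith))
    (mul_nonneg (by positivity) (by linarith))

theorem spline_eq_quadratic {γ u w : ℝ} (hγ : 0 < γ) (hu : |u| ≤ 1) (hw : |w| ≤ 1) :
    spline γ w = spline γ u + splineDeriv γ u * (w - u) - (w - u) ^ 2 / (1 + γ) := by
  rw [splineDeriv_of_abs_le_one hγ hu, spline, spline, if_pos hu, if_pos hw]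
  field_simp
  ring

/-- In t, the derivative of f(tu) is f'(tu)u ≥ -2/t ≥ -2 for t ≥ 1. -/
theorem spline_sub_le_spline_mul {γ c : ℝ} (hγ : 0 < γ) (hc : 1 ≤ c) (u : ℝ) :
    spline γ u - 2 * (c - 1) ≤ spline γ (c * u) := by
  have hd : ∀ t : ℝ, HasDerivAt (fun t => spline γ (t * u)) (splineDeriv γ (t * u) * u) t :=
    fun t => by
      have h := (hasDerivAt_spline hγ (t * u)).comp t ((hasDerivAt_id t).mul_const u)
      simpa [Function.comp_def] using h
  have h := Convex.mul_sub_le_image_sub_of_le_deriv (convex_Icc 1 c)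
    (f := fun t => spline γ (t * u)) (C := -2)
    (fun t _ => (hd t).continuousAt.continuousWithinAt)
    (fun t _ => (hd t).differentiableAt.differentiableWithinAt)
    (fun t ht => by
      rw [interior_Icc] at ht
      rw [(hd t).deriv]
      have h1 := (splineDeriv_mul_self_mem hγ (t * u))
      have h2 : splineDeriv γ (t * u) * (t * u) = t * (splineDeriv γ (t * u) * u) := by ring
      rw [h2] at h1
      nlinarith [h1.1, ht.1]) 1 ⟨le_rfl, hc⟩ c ⟨hc, le_rfl⟩ hc
  simp only [one_mul] at h
  linarith

end SL0

namespace SL0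

/-! ### The cost function on cosets of a subspace with a null space property -/

theorem cost_one {m : ℕ} (γ : ℝ) (z : EuclideanSpace ℝ (Fin m)) :
    cost γ 1 z = ∑ i, spline γ (z i) := by
  simp [cost]

theorem cost_eq_cost_one {m : ℕ} (γ σ : ℝ) (z : EuclideanSpace ℝ (Fin m)) :
    cost γ σ z = cost γ 1 (σ⁻¹ • z) := by
  simp [cost, div_eq_inv_mul]

theorem cost_le_card {m : ℕ} {γ : ℝ} (hγ : 0 ≤ γ) (σ : ℝ) (z : EuclideanSpace ℝ (Fin m)) :
    cost γ σ z ≤ m := by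
  refine (Finset.sum_le_sum fun i _ => spline_le_one hγ _).trans ?_
  simp

/-- The gradient of `cost γ 1`, for `γ > 0`. -/
def costGrad {m : ℕ} (γ : ℝ) (z : EuclideanSpace ℝ (Fin m)) : EuclideanSpace ℝ (Fin m) :=
  WithLp.toLp 2 fun i => splineDeriv γ (z i)

theorem hasGradientAt_cost {m : ℕ} {γ : ℝ} (hγ : 0 < γ) (σ : ℝ) (z : EuclideanSpace ℝ (Fin m)) :
    HasGradientAt (cost γ σ) (σ⁻¹ • costGrad γ (σ⁻¹ • z)) z := by
  rw [hasGradientAt_iff_hasFDerivAt]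
  have h : ∀ i, HasFDerivAt (fun w : EuclideanSpace ℝ (Fin m) => spline γ (w i / σ))
      ((splineDeriv γ (z i / σ) * σ⁻¹) • EuclideanSpace.proj (𝕜 := ℝ) i) z := fun i => by
    have h1 : HasFDerivAt (fun w : EuclideanSpace ℝ (Fin m) => w i / σ)
        (σ⁻¹ • EuclideanSpace.proj (𝕜 := ℝ) i) z := by
      simpa [div_eq_inv_mul] using
        ((EuclideanSpace.proj i : EuclideanSpace ℝ (Fin m) →L[ℝ] ℝ).hasFDerivAt (x := z)).const_mul
          σ⁻¹
    simpa [smul_smul, Function.comp_def] using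
      (hasDerivAt_spline hγ (z i / σ)).comp_hasFDerivAt z h1
  have h2 := HasFDerivAt.fun_sum (u := Finset.univ) fun i _ => h i
  refine h2.congr_fderiv ?_
  ext w
  simp only [sum_apply, InnerProductSpace.toDual_apply_apply,
    PiLp.inner_apply, smul_apply, costGrad, PiLp.smul_apply, PiLp.proj_apply,
    RCLike.inner_apply, smul_eq_mul, conj_trivial]
  exact Finset.sum_congr rfl fun i _ => by rw [div_eq_inv_mul]; ring

theorem continuous_cost {m : ℕ} {γ : ℝ} (hγ : 0 < γ) (σ : ℝ) :
    Continuous (cost γ σ : EuclideanSpace ℝ (Fin m) → ℝ) :=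
  continuous_iff_continuousAt.2 fun z =>
    ((hasGradientAt_iff_hasFDerivAt.1 (hasGradientAt_cost hγ σ z))).continuousAt

theorem continuous_costGrad {m : ℕ} (γ : ℝ) :
    Continuous (costGrad γ : EuclideanSpace ℝ (Fin m) → _) := by
  unfold costGrad
  refine (PiLp.continuous_toLp 2 _).comp (continuous_pi fun i => ?_)
  exact (continuous_splineDeriv γ).comp (EuclideanSpace.proj i).continuous

/-! ### Critical points and superlevel sets on cosets. -/

variable {m : ℕ} {K : Submodule ℝ (EuclideanSpace ℝ (Fin m))} {N : ℕ} {γ : ℝ}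

/-- `z` is a critical point of `cost γ 1` on the coset `z + K`. -/
def IsCrit (K : Submodule ℝ (EuclideanSpace ℝ (Fin m))) (γ : ℝ)
    (z : EuclideanSpace ℝ (Fin m)) : Prop :=
  ∀ v ∈ K, inner ℝ (costGrad γ z) v = 0

theorem isClosed_isCrit (K : Submodule ℝ (EuclideanSpace ℝ (Fin m))) (γ : ℝ) :
    IsClosed {z | IsCrit K γ z} := by
  simp only [IsCrit, Set.ofPred_forall]
  refine isClosed_iInter fun v => isClosed_iInter fun _ => ?_
  exact isClosed_eq ((continuous_costGrad γ).inner continuous_const) continuous_const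

theorem isCrit_of_eventually_le (hγ : 0 < γ) {q : EuclideanSpace ℝ (Fin m)}
    (h : ∀ᶠ w in 𝓝 q, w - q ∈ K → cost γ 1 w ≤ cost γ 1 q) : IsCrit K γ q := by
  intro v hv
  have hl : HasDerivAt (fun t : ℝ => q + t • v) v 0 := by
    simpa using ((hasDerivAt_id (0 : ℝ)).smul_const v).const_add q
  have hg : HasFDerivAt (cost γ 1) _ (q + (0 : ℝ) • v) :=
    hasGradientAt_iff_hasFDerivAt.1 (hasGradientAt_cost hγ 1 (q + (0 : ℝ) • v))
  have hd := hg.comp_hasDerivAt (0 : ℝ) hl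
  have hmax : IsLocalMax (cost γ 1 ∘ fun t : ℝ => q + t • v) 0 := by
    have ht : Tendsto (fun t : ℝ => q + t • v) (𝓝 0) (𝓝 q) := by
      simpa using hl.continuousAt.tendsto
    filter_upwards [ht.eventually h] with t ht
    simpa using ht (by simpa using K.smul_mem t hv)
  simpa using hmax.hasDerivAt_eq_zero hd

/-- Every element of `K` has, on each set of at most `N` indices, at most `γ` times the energy
that it has off this set. -/
def NullSpaceProperty (K : Submodule ℝ (EuclideanSpace ℝ (Fin m))) (N : ℕ) (γ : ℝ) : Prop :=
  ∀ I : Finset (Fin m), I.card ≤ N → ∀ v ∈ K, ∑ i ∈ I, v i ^ 2 ≤ γ * ∑ i ∈ Iᶜ, v i ^ 2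

/-- The spare index gives strictness: moving some j outside I with v j ≠ 0 into I shifts v j ² from
the right side to the left. If there is no such j, then v vanishes off I and the inequality forces v
= 0. -/
theorem NullSpaceProperty.lt (hK : NullSpaceProperty K N γ) (hγ : 0 ≤ γ) {I : Finset (Fin m)}
    (hI : I.card < N) {v : EuclideanSpace ℝ (Fin m)} (hv : v ∈ K) (hv0 : v ≠ 0) :
    ∑ i ∈ I, v i ^ 2 < γ * ∑ i ∈ Iᶜ, v i ^ 2 := by
  obtain ⟨j, hjI, hj⟩ : ∃ j, j ∉ I ∧ v j ≠ 0 := by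
    by_contra! h
    have h1 := hK I hI.le v hv
    rw [Finset.sum_eq_zero (s := Iᶜ) fun i hi => by simp [h i (Finset.mem_compl.1 hi)], mul_zero]
      at h1
    have h2 := (Finset.sum_eq_zero_iff_of_nonneg fun i _ => sq_nonneg (v i)).1
      (le_antisymm h1 (Finset.sum_nonneg fun i _ => sq_nonneg (v i)))
    refine hv0 ?_
    ext i
    by_cases hi : i ∈ I
    · simpa using h2 i hi
    · simpa using h i hi
  have h := hK (insert j I) (by rw [Finset.card_insert_of_notMem hjI]; omega) v hv
  rw [Finset.sum_insert hjI, Finset.compl_insert] at h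
  have h1 := Finset.add_sum_erase Iᶜ (fun i => v i ^ 2) (Finset.mem_compl.2 hjI)
  rw [← h1]
  have := sq_pos_of_ne_zero hj
  nlinarith [mul_nonneg hγ this.le]

/-- If `q` is critical and few entries of `q` or `z` exceed `1`, then the cost is strictly concave
enough for `q` to beat `z`. -/
theorem IsCrit.cost_lt {q z : EuclideanSpace ℝ (Fin m)} (hK : NullSpaceProperty K N γ) (hγ : 0 < γ)
    (hq : IsCrit K γ q) (hqz : z - q ∈ K) (hne : z ≠ q) {I : Finset (Fin m)} (hI : I.card < N)
    (hqI : ∀ i ∉ I, |q i| ≤ 1) (hzI : ∀ i ∉ I, |z i| ≤ 1) : cost γ 1 z < cost γ 1 q := by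
  have h0 : ∑ i, splineDeriv γ (q i) * (z i - q i) = 0 := by
    have := hq _ hqz
    simpa [costGrad, PiLp.inner_apply, mul_comm] using this
  have h1 := hK.lt hγ.le hI hqz (sub_ne_zero.2 hne)
  simp only [PiLp.sub_apply] at h1
  rw [cost_one, cost_one, ← Finset.sum_add_sum_compl I, ← Finset.sum_add_sum_compl I (fun i => spline γ (q i))]
  rw [← Finset.sum_add_sum_compl I] at h0
  have h2 : ∑ i ∈ I, spline γ (z i) ≤ ∑ i ∈ I, spline γ (q i)
      + ∑ i ∈ I, splineDeriv γ (q i) * (z i - q i) + (∑ i ∈ I, (z i - q i) ^ 2) / (γ ^ 2 + γ) := by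
    rw [Finset.sum_div, ← Finset.sum_add_distrib, ← Finset.sum_add_distrib]
    exact Finset.sum_le_sum fun i _ => spline_le_quadratic hγ _ _
  have h3 : ∑ i ∈ Iᶜ, spline γ (z i) = ∑ i ∈ Iᶜ, spline γ (q i)
      + ∑ i ∈ Iᶜ, splineDeriv γ (q i) * (z i - q i) - (∑ i ∈ Iᶜ, (z i - q i) ^ 2) / (1 + γ) := by
    rw [Finset.sum_div, ← Finset.sum_add_distrib, ← Finset.sum_sub_distrib]
    refine Finset.sum_congr rfl fun i hi => ?_
    rw [Finset.mem_compl] at hi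
    exact spline_eq_quadratic hγ (hqI i hi) (hzI i hi)
  -- The curvature bounds on I and Iᶜ have ratio 1/γ, which the strict null space inequality for z -
  -- q exactly compensates.
  have h4 : (∑ i ∈ I, (z i - q i) ^ 2) / (γ ^ 2 + γ) < (∑ i ∈ Iᶜ, (z i - q i) ^ 2) / (1 + γ) := by
    rw [div_lt_div_iff₀ (by positivity) (by positivity)]
    nlinarith
  linarith

theorem card_large_lt (hγ : 0 ≤ γ) {z : EuclideanSpace ℝ (Fin m)}
    (hz : m - N / (1 + γ) < cost γ 1 z) :
    (Finset.univ.filter fun i => 1 ≤ |z i|).card < N := by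
  set I := Finset.univ.filter fun i => 1 ≤ |z i| with hI
  have h1 : cost γ 1 z ≤ ∑ i, (1 - if i ∈ I then 1 / (1 + γ) else 0) := by
    rw [cost_one]
    refine Finset.sum_le_sum fun i _ => ?_
    split_ifs with h
    · exact spline_le_of_one_le_abs hγ (Finset.mem_filter.1 h).2
    · simpa using spline_le_one hγ _
  rw [Finset.sum_sub_distrib, Finset.sum_ite_mem, Finset.univ_inter] at h1
  simp only [Finset.sum_const, Finset.card_univ, Fintype.card_fin, nsmul_eq_mul, mul_one] at h1
  have h2 : (I.card : ℝ) / (1 + γ) < N / (1 + γ) := by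
    rw [div_eq_mul_one_div]; linarith
  exact_mod_cast (div_lt_div_iff_of_pos_right (by linarith : 0 < 1 + γ)).1 h2

/-- Control of the coordinates off I suffices, because the null space inequality pays for those on
I. -/
theorem norm_sub_sq_le (hK : NullSpaceProperty K N γ) (hγ : 0 ≤ γ) {p z : EuclideanSpace ℝ (Fin m)}
    (hz : z - p ∈ K) {I : Finset (Fin m)} (hI : I.card ≤ N) {C : ℝ}
    (hC : ∀ i ∉ I, |z i - p i| ≤ C) : ‖z - p‖ ^ 2 ≤ (1 + γ) * (m * C ^ 2) := by
  have h1 := hK I hI _ hz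
  have h2 : ∑ i ∈ Iᶜ, (z - p) i ^ 2 ≤ m * C ^ 2 := by
    refine (Finset.sum_le_card_nsmul _ _ (C ^ 2) fun i hi => ?_).trans ?_
    · rw [← sq_abs]
      exact pow_le_pow_left₀ (abs_nonneg _) (hC i (Finset.mem_compl.1 hi)) 2
    · rw [nsmul_eq_mul]
      refine mul_le_mul_of_nonneg_right ?_ (sq_nonneg _)
      exact_mod_cast (Finset.card_le_univ _).trans (by simp)
  rw [EuclideanSpace.real_norm_sq_eq, ← Finset.sum_add_sum_compl I]
  nlinarith

theorem norm_le_of_lt_cost (hK : NullSpaceProperty K N γ) (hγ : 0 ≤ γ)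
    {p z : EuclideanSpace ℝ (Fin m)} (hz : z - p ∈ K) (hc : m - N / (1 + γ) < cost γ 1 z) :
    ‖z‖ ≤ ‖p‖ + √((1 + γ) * (m * (1 + ‖p‖) ^ 2)) := by
  have h := norm_sub_sq_le hK hγ hz (card_large_lt hγ hc).le (C := 1 + ‖p‖) fun i hi => by
    simp only [Finset.mem_filter, Finset.mem_univ, true_and, not_le] at hi
    refine (abs_sub _ _).trans (add_le_add hi.le ?_)
    simpa using PiLp.norm_apply_le p i
  have h2 := Real.le_sqrt_of_sq_le h
  have h3 := norm_add_le p (z - p)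
  rw [add_sub_cancel] at h3
  linarith

theorem isClosed_coset (K : Submodule ℝ (EuclideanSpace ℝ (Fin m)))
    (p : EuclideanSpace ℝ (Fin m)) : IsClosed {z | z - p ∈ K} :=
  K.closed_of_finiteDimensional.preimage (continuous_id.sub continuous_const)

theorem isCompact_superlevel (hK : NullSpaceProperty K N γ) (hγ : 0 < γ) {v : ℝ}
    (hv : m - N / (1 + γ) < v) (p : EuclideanSpace ℝ (Fin m)) :
    IsCompact {z | z - p ∈ K ∧ v ≤ cost γ 1 z} := by
  refine (isCompact_closedBall (0 : EuclideanSpace ℝ (Fin m))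
    (‖p‖ + √((1 + γ) * (m * (1 + ‖p‖) ^ 2)))).of_isClosed_subset
    ((isClosed_coset K p).inter (isClosed_le continuous_const (continuous_cost hγ 1))) ?_
  intro z hz
  rw [mem_closedBall_zero_iff]
  exact norm_le_of_lt_cost hK hγ.le hz.1 (hv.trans_le hz.2)

/-- A critical point at a high level persists as the coset is shrunk slightly towards `K`. -/
theorem IsCrit.exists_near (hK : NullSpaceProperty K N γ) (hγ : 0 < γ)
    {q : EuclideanSpace ℝ (Fin m)} (hq : IsCrit K γ q) (hc : m - N / (1 + γ) < cost γ 1 q) {r : ℝ}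
    (hr : 0 < r) :
    ∀ᶠ t : ℝ in 𝓝[<] 1, ∃ q', q' - t • q ∈ K ∧ IsCrit K γ q' ∧ cost γ 1 q ≤ cost γ 1 q' ∧
      dist q' q < r := by
  have hcard := card_large_lt hγ.le hc
  set I := Finset.univ.filter fun i => 1 ≤ |q i| with hI
  have hqI : ∀ i ∉ I, |q i| < 1 := fun i hi => by simpa [hI] using hi
  have hev : ∀ᶠ w in 𝓝 q, ∀ i ∉ I, |w i| ≤ 1 := by
    simp only [eventually_all]
    intro i hi
    have : Tendsto (fun w : EuclideanSpace ℝ (Fin m) => |w i|) (𝓝 q) (𝓝 |q i|) :=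
      (Continuous.tendsto (by fun_prop) q)
    exact (this.eventually (gt_mem_nhds (hqI i hi))).mono fun w hw => le_of_lt hw
  obtain ⟨ρ₀, hρ₀, hball⟩ := Metric.eventually_nhds_iff_ball.1 hev
  set ρ := min (ρ₀ / 2) (r / 2) with hρdef
  have hρ : 0 < ρ := lt_min (by linarith) (by linarith)
  have hρ1 : ρ < ρ₀ := (min_le_left _ _).trans_lt (by linarith)
  have hρ2 : ρ ≤ r / 2 := min_le_right _ _
  have hcl := isClosed_coset K q
  have hcont : Continuous fun x : ℝ × EuclideanSpace ℝ (Fin m) => cost γ 1 (x.1 • x.2) :=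
    (continuous_cost hγ 1).comp (continuous_fst.smul continuous_snd)
  -- At t = 1 strict concavity puts the sphere around q strictly below q; compactness of the sphere
  -- preserves this for t near 1.
  have hsph : ∀ᶠ t : ℝ in 𝓝 1, ∀ w ∈ Metric.sphere q ρ ∩ {w | w - q ∈ K},
      cost γ 1 (t • w) < cost γ 1 q := by
    refine ((isCompact_sphere q ρ).inter_right hcl).eventually_forall_of_forall_eventually ?_
    intro w hw
    have hlt : cost γ 1 ((1 : ℝ) • w) < cost γ 1 q := by
      rw [one_smul]
      refine hq.cost_lt hK hγ hw.2 ?_ hcard (fun i hi => (hqI i hi).le)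
        (hball w (by rw [Metric.mem_ball, Metric.mem_sphere.1 hw.1]; exact hρ1))
      rintro rfl
      have := hw.1
      simp [hρ.ne] at this
    exact (hcont.tendsto (1, w)).eventually (gt_mem_nhds hlt)
  have hsmall : ∀ᶠ t : ℝ in 𝓝 1, |t - 1| * (‖q‖ + ρ) < r / 2 := by
    have : Tendsto (fun t : ℝ => |t - 1| * (‖q‖ + ρ)) (𝓝 1) (𝓝 (|1 - 1| * (‖q‖ + ρ))) :=
      (Continuous.tendsto (by fun_prop) 1)
    refine this.eventually (gt_mem_nhds ?_)
    simpa using hr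
  have hpos : ∀ᶠ t : ℝ in 𝓝 1, 0 < t := lt_mem_nhds one_pos
  filter_upwards [nhdsWithin_le_nhds hsph, nhdsWithin_le_nhds hsmall, nhdsWithin_le_nhds hpos,
    self_mem_nhdsWithin] with t h1 h2 h3 h4
  rw [Set.mem_Iio] at h4
  -- The rescaled centre is no lower than q while the rescaled sphere lies below q, so a maximizer
  -- over the ball is interior and hence critical.
  have hqt : cost γ 1 q ≤ cost γ 1 (t • q) := by
    rw [cost_one, cost_one]
    refine Finset.sum_le_sum fun i _ => spline_le_spline hγ.le ?_
    rw [PiLp.smul_apply, smul_eq_mul, abs_mul, abs_of_pos h3]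
    exact mul_le_of_le_one_left (abs_nonneg _) h4.le
  obtain ⟨w, hw, hwmax⟩ := ((isCompact_closedBall q ρ).inter_right hcl).exists_isMaxOn
    ⟨q, Metric.mem_closedBall_self hρ.le, by simp⟩
    ((continuous_cost hγ 1).comp (continuous_const_smul t)).continuousOn
  have hwq : cost γ 1 q ≤ cost γ 1 (t • w) :=
    hqt.trans (hwmax (a := q) ⟨Metric.mem_closedBall_self hρ.le, by simp⟩)
  have hwb : dist w q < ρ := by
    refine lt_of_le_of_ne hw.1 fun h => ?_
    exact absurd (h1 w ⟨h, hw.2⟩) (not_lt.2 hwq)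
  refine ⟨t • w, ?_, ?_, hwq, ?_⟩
  · rw [← smul_sub]; exact K.smul_mem t hw.2
  · refine isCrit_of_eventually_le hγ ?_
    have ht : Tendsto (fun u : EuclideanSpace ℝ (Fin m) => t⁻¹ • u) (𝓝 (t • w)) (𝓝 w) := by
      have := (continuous_const_smul t⁻¹ (T := EuclideanSpace ℝ (Fin m))).tendsto (t • w)
      rwa [inv_smul_smul₀ h3.ne'] at this
    filter_upwards [ht.eventually (Metric.ball_mem_nhds w (sub_pos.2 hwb))] with u hu huK
    have hu1 : dist (t⁻¹ • u) q ≤ ρ := by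
      have := dist_triangle (t⁻¹ • u) w q
      linarith
    have hu2 : t⁻¹ • u - q ∈ K := by
      have e : t⁻¹ • u - q = t⁻¹ • (u - t • w) + (w - q) := by
        rw [smul_sub, inv_smul_smul₀ h3.ne']; abel
      rw [e]
      exact K.add_mem (K.smul_mem _ huK) hw.2
    have := hwmax (a := t⁻¹ • u) ⟨hu1, hu2⟩
    simpa [smul_inv_smul₀ h3.ne'] using this
  · have e1 : dist (t • w) w = |t - 1| * ‖w‖ := by
      rw [dist_eq_norm, ← Real.norm_eq_abs, ← norm_smul, sub_smul, one_smul]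
    have e2 : ‖w‖ ≤ ‖q‖ + ρ := by
      have := norm_le_norm_add_norm_sub' w q
      rw [dist_eq_norm] at hwb
      linarith
    have := dist_triangle (t • w) w q
    nlinarith [mul_le_mul_of_nonneg_left e2 (abs_nonneg (t - 1))]

/-- On a coset of `K` there is at most one critical point at a high level. The proof shrinks the
coset to `K` itself, where `0` is the only such point. -/
theorem IsCrit.eq_of_lt_cost (hK : NullSpaceProperty K N γ) (hγ : 0 < γ)
    {q z : EuclideanSpace ℝ (Fin m)} (hq : IsCrit K γ q) (hz : IsCrit K γ z) (hqz : q - z ∈ K)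
    (hcq : m - N / (1 + γ) < cost γ 1 q) (hcz : m - N / (1 + γ) < cost γ 1 z) : q = z := by
  by_contra hne
  set v := min (cost γ 1 q) (cost γ 1 z) with hv
  have hvN : m - N / (1 + γ) < v := lt_min hcq hcz
  set G : ℝ → EuclideanSpace ℝ (Fin m) → Prop := fun t w =>
    w - t • z ∈ K ∧ IsCrit K γ w ∧ v ≤ cost γ 1 w with hG
  -- Parameters whose coset has two distinct high critical points. `T` within [0, 1] is closed and
  -- extends to the left of each of its positive points, so 1 ∈ `T` forces 0 ∈ `T`.
  set T : Set ℝ := {t | ∃ q' z', q' ≠ z' ∧ G t q' ∧ G t z'} with hT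
  have h1T : (1 : ℝ) ∈ T := ⟨q, z, hne, ⟨by simpa using hqz, hq, min_le_left _ _⟩,
    ⟨by simp, hz, min_le_right _ _⟩⟩
  have hbdd : ∃ R : ℝ, ∀ t ∈ Set.Icc (0 : ℝ) 1, ∀ w, G t w → ‖w‖ ≤ R := by
    refine ⟨‖z‖ + √((1 + γ) * (m * (1 + ‖z‖) ^ 2)), fun t ht w hw => ?_⟩
    refine (norm_le_of_lt_cost hK hγ.le hw.1 (hvN.trans_le hw.2.2)).trans ?_
    have : ‖t • z‖ ≤ ‖z‖ := by
      rw [norm_smul, Real.norm_eq_abs, abs_of_nonneg ht.1]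
      exact mul_le_of_le_one_left (norm_nonneg _) ht.2
    gcongr
  obtain ⟨R, hR⟩ := hbdd
  have hclosed : IsClosed (T ∩ Set.Icc 0 1) := by
    refine IsSeqClosed.isClosed fun u t hu hut => ?_
    have ht : t ∈ Set.Icc (0 : ℝ) 1 := isClosed_Icc.mem_of_tendsto hut
      (Eventually.of_forall fun n => (hu n).2)
    choose a b hab ha hb using fun n => (hu n).1
    have hmem : ∀ n, (a n, b n) ∈ Metric.closedBall (0 : EuclideanSpace ℝ (Fin m)) R ×ˢ
        Metric.closedBall (0 : EuclideanSpace ℝ (Fin m)) R := fun n => by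
      simp only [Set.mem_prod, mem_closedBall_zero_iff]
      exact ⟨hR _ (hu n).2 _ (ha n), hR _ (hu n).2 _ (hb n)⟩
    obtain ⟨⟨a', b'⟩, -, φ, hφ, hlim⟩ :=
      ((isCompact_closedBall _ _).prod (isCompact_closedBall _ _)).tendsto_subseq hmem
    have hla : Tendsto (a ∘ φ) atTop (𝓝 a') := (continuous_fst.tendsto _).comp hlim
    have hlb : Tendsto (b ∘ φ) atTop (𝓝 b') := (continuous_snd.tendsto _).comp hlim
    have hlu := hut.comp hφ.tendsto_atTop
    have hGclosed : ∀ (c : ℕ → EuclideanSpace ℝ (Fin m)) (c' : EuclideanSpace ℝ (Fin m)),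
        (∀ n, G (u n) (c n)) → Tendsto (c ∘ φ) atTop (𝓝 c') → G t c' := fun c c' hc hlc =>
      ⟨K.closed_of_finiteDimensional.mem_of_tendsto (hlc.sub (hlu.smul_const z))
          (Eventually.of_forall fun n => (hc (φ n)).1),
        (isClosed_isCrit K γ).mem_of_tendsto hlc (Eventually.of_forall fun n => (hc (φ n)).2.1),
        ge_of_tendsto (((continuous_cost hγ 1).tendsto c').comp hlc)
          (Eventually.of_forall fun n => (hc (φ n)).2.2)⟩
    have hGa := hGclosed a a' ha hla
    have hGb := hGclosed b b' hb hlb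
    refine ⟨⟨a', b', ?_, hGa, hGb⟩, ht⟩
    -- If the two limits coincided, late pairs would both lie where strict concavity applies, and
    -- each would have strictly lower cost than the other.
    rintro rfl
    have hcard := card_large_lt hγ.le (hvN.trans_le hGa.2.2)
    set I := Finset.univ.filter fun i => 1 ≤ |a' i| with hI
    have hev : ∀ c : ℕ → EuclideanSpace ℝ (Fin m), Tendsto (c ∘ φ) atTop (𝓝 a') →
        ∀ᶠ n in atTop, ∀ i ∉ I, |c (φ n) i| ≤ 1 := fun c hc => by
      simp only [eventually_all]
      intro i hi
      have h1 : Tendsto (fun w : EuclideanSpace ℝ (Fin m) => |w i|) (𝓝 a') (𝓝 |a' i|) :=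
        Continuous.tendsto (by fun_prop) a'
      exact ((h1.comp hc).eventually (gt_mem_nhds (by simpa [hI] using hi))).mono
        fun n hn => le_of_lt hn
    obtain ⟨n, hna, hnb⟩ := ((hev a hla).and (hev b hlb)).exists
    have hKab : a (φ n) - b (φ n) ∈ K := by
      simpa using K.sub_mem (ha (φ n)).1 (hb (φ n)).1
    have l1 := (ha (φ n)).2.1.cost_lt hK hγ (by simpa using K.neg_mem hKab) (hab (φ n)).symm hcard hna hnb
    have l2 := (hb (φ n)).2.1.cost_lt hK hγ hKab (hab (φ n)) hcard hnb hna
    exact lt_asymm l1 l2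
  have h0T : (0 : ℝ) ∈ T := by
    refine hclosed.Icc_subset_of_forall_exists_lt h1T ?_ (Set.left_mem_Icc.2 zero_le_one)
    rintro t ⟨⟨a, b, hab, ha, hb⟩, ht0, ht1⟩ y hy
    rw [Set.mem_Iio] at hy
    -- Moving each point by less than half their distance keeps the two apart.
    have hd : 0 < dist a b / 2 := half_pos (dist_pos.2 hab)
    have ea := ha.2.1.exists_near hK hγ (hvN.trans_le ha.2.2) hd
    have eb := hb.2.1.exists_near hK hγ (hvN.trans_le hb.2.2) hd
    have ey : ∀ᶠ s : ℝ in 𝓝[<] 1, y < s * t := by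
      refine nhdsWithin_le_nhds ?_
      have : Tendsto (fun s : ℝ => s * t) (𝓝 1) (𝓝 (1 * t)) := Continuous.tendsto (by fun_prop) 1
      exact this.eventually (lt_mem_nhds (by simpa using hy))
    obtain ⟨s, ⟨⟨⟨a', ka, ca, va, da⟩, ⟨b', kb, cb, vb, db⟩⟩, hys⟩, hs1⟩ :=
      (((ea.and eb).and ey).and self_mem_nhdsWithin).exists
    have hmem : ∀ w w' : EuclideanSpace ℝ (Fin m), w - t • z ∈ K → w' - s • w ∈ K →
        w' - (s * t) • z ∈ K := fun w w' h h' => by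
      have := K.add_mem h' (K.smul_mem s h)
      rwa [smul_sub, smul_smul, sub_add_sub_cancel] at this
    refine ⟨s * t, ⟨a', b', ?_, ⟨hmem _ _ ha.1 ka, ca, ha.2.2.trans va⟩,
      ⟨hmem _ _ hb.1 kb, cb, hb.2.2.trans vb⟩⟩, hys.le, by nlinarith⟩
    rintro rfl
    have := dist_triangle_left a b a'
    linarith
  have hzero : ∀ w, G 0 w → w = 0 := fun w hw => by
    by_contra hw0
    have hw1 : w ∈ K := by simpa using hw.1
    have hcard := card_large_lt hγ.le (hvN.trans_le hw.2.2)
    -- A nonzero high critical point on K would beat 0, where the cost takes its largest value m.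
    have hlt := hw.2.1.cost_lt hK hγ (z := 0) (by simpa using hw1) (Ne.symm hw0) hcard
      (fun i hi => by
        simp only [Finset.mem_filter, Finset.mem_univ, true_and, not_le] at hi
        exact hi.le) (fun i _ => by simp)
    have h0 : cost γ 1 (0 : EuclideanSpace ℝ (Fin m)) = m := by simp [cost_one, spline_zero]
    rw [h0] at hlt
    exact absurd hlt (not_lt.2 (cost_le_card hγ.le 1 w))
  obtain ⟨a, b, hab, ha, hb⟩ := h0T
  exact hab ((hzero a ha).trans (hzero b hb).symm)

end SL0

namespace SL0

/-! ### Steepest ascent trajectories -/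

/-- A bounded Lipschitz vector field has an integral curve on `[0, ∞)` through every point. -/
theorem exists_integralCurve_Ici {E : Type*} [NormedAddCommGroup E] [NormedSpace ℝ E]
    [CompleteSpace E] {X : E → E} {C : NNReal} (hX : LipschitzWith C X) {B : NNReal}
    (hB : ∀ z, ‖X z‖ ≤ B) (p : E) :
    ∃ a : ℝ → E, a 0 = p ∧ ∀ t, 0 ≤ t → HasDerivWithinAt a (X (a t)) (Set.Ici 0) t := by
  have hloc : ∀ n : ℕ, ∃ a : ℝ → E, a 0 = p ∧
      ∀ t ∈ Set.Icc (0 : ℝ) n, HasDerivWithinAt a (X (a t)) (Set.Icc 0 n) t := fun n => by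
    -- With speed at most B, a curve stays within B * n of p up to time n, so no blow-up has to be
    -- excluded.
    have hPL : IsPicardLindelof (fun _ => X) (⟨0, by simp⟩ : Set.Icc (0 : ℝ) n) p (B * n) 0 B C :=
      { lipschitzOnWith := fun _ _ => hX.lipschitzOnWith
        continuousOn := fun _ _ => continuousOn_const
        norm_le := fun _ _ z _ => hB z
        mul_max_le := by simp }
    exact hPL.exists_eq_forall_mem_Icc_hasDerivWithinAt₀
  choose a ha0 ha using hloc
  have hcoh : ∀ n k : ℕ, n ≤ k → Set.EqOn (a n) (a k) (Set.Icc 0 n) := fun n k hnk => by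
    have hd : ∀ j : ℕ, n ≤ j → ∀ t ∈ Set.Ico (0 : ℝ) n,
        HasDerivWithinAt (a j) (X (a j t)) (Set.Ici t) t := fun j hj t ht => by
      have hnj : (n : ℝ) ≤ j := by exact_mod_cast hj
      refine (ha j t ⟨ht.1, ht.2.le.trans hnj⟩).mono_of_mem_nhdsWithin ?_
      exact mem_of_superset (Icc_mem_nhdsGE (ht.2.trans_le hnj)) (Set.Icc_subset_Icc_left ht.1)
    have hc : ∀ j : ℕ, n ≤ j → ContinuousOn (a j) (Set.Icc 0 n) := fun j hj =>
      (HasDerivWithinAt.continuousOn (ha j)).mono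
        (Set.Icc_subset_Icc_right (by exact_mod_cast hj))
    exact ODE_solution_unique (v := fun _ => X) (fun _ => hX) (hc n le_rfl) (hd n le_rfl)
      (hc k hnk) (hd k hnk) ((ha0 n).trans (ha0 k).symm)
  -- The extra 1 puts t strictly before the end of the interval, which is then a neighbourhood of t
  -- in [0, ∞).
  refine ⟨fun t => a (⌈t⌉₊ + 1) t, by simp [ha0], fun t ht => ?_⟩
  set k := ⌈t⌉₊ + 1 with hk
  have htk : t < k := by
    rw [hk]; push_cast; linarith [Nat.le_ceil t]
  have hnhds : Set.Icc (0 : ℝ) k ∈ 𝓝[Set.Ici 0] t := by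
    rw [← Set.Ici_inter_Iic]
    exact inter_mem self_mem_nhdsWithin (nhdsWithin_le_nhds (Iic_mem_nhds htk))
  refine ((ha k t ⟨ht, htk.le⟩).mono_of_mem_nhdsWithin hnhds).congr_of_eventuallyEq ?_ rfl
  filter_upwards [hnhds] with s hs
  rcases le_total (⌈s⌉₊ + 1) k with h | h
  · exact hcoh _ _ h ⟨hs.1, by push_cast; linarith [Nat.le_ceil s]⟩
  · exact (hcoh _ _ h hs).symm

variable {n m : ℕ}

theorem IsSteepestAscent.toLin_eq {A : Matrix (Fin n) (Fin m) ℝ}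
    {F : EuclideanSpace ℝ (Fin m) → ℝ} {p : EuclideanSpace ℝ (Fin m)}
    {a : ℝ → EuclideanSpace ℝ (Fin m)} (ha : IsSteepestAscent A F p a) {t : ℝ} (ht : 0 ≤ t) :
    toLin A (a t) = toLin A p := by
  have h1 : ∀ s ∈ Set.Ici (0 : ℝ), HasDerivWithinAt
      (fun s => (toLin A).toContinuousLinearMap (a s)) 0 (Set.Ici 0) s := fun s hs => by
    have h := (toLin A).toContinuousLinearMap.hasFDerivAt.comp_hasDerivWithinAt s (ha.2 s hs)
    refine h.congr_deriv ?_
    exact LinearMap.mem_ker.1 (Submodule.starProjection_apply_mem _ _)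
  have h2 := (convex_Ici (0 : ℝ)).norm_image_sub_le_of_norm_hasDerivWithin_le (C := 0) h1
    (fun _ _ => by simp) (x := 0) (y := t) Set.self_mem_Ici ht
  rw [zero_mul, norm_le_zero_iff, sub_eq_zero, ha.1] at h2
  exact h2

/-- A steepest ascent trajectory whose superlevel set is compact and contains just one critical
point `q`, where `F` is largest, converges to `q`. -/
theorem IsSteepestAscent.tendsto {A : Matrix (Fin n) (Fin m) ℝ}
    {F : EuclideanSpace ℝ (Fin m) → ℝ} {G : EuclideanSpace ℝ (Fin m) → EuclideanSpace ℝ (Fin m)}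
    (hF : ∀ z, HasGradientAt F (G z) z) (hG : Continuous G) {p q : EuclideanSpace ℝ (Fin m)}
    {a : ℝ → EuclideanSpace ℝ (Fin m)} (ha : IsSteepestAscent A F p a)
    (hS : IsCompact {z | toLin A z = toLin A p ∧ F p ≤ F z})
    (hcrit : ∀ z, toLin A z = toLin A p → F p ≤ F z →
      (LinearMap.ker (toLin A)).starProjection (G z) = 0 → z = q)
    (hmax : ∀ z, toLin A z = toLin A p → F q ≤ F z → z = q) :
    Tendsto a atTop (𝓝 q) := by
  set P := (LinearMap.ker (toLin A)).starProjection with hP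
  have hA : ∀ t, 0 ≤ t → toLin A (a t) = toLin A p := fun t ht => ha.toLin_eq ht
  obtain ⟨ha0, hd⟩ := ha
  simp only [(hF _).gradient] at hd
  have hFc : Continuous F :=
    continuous_iff_continuousAt.2 fun z => (hasGradientAt_iff_hasFDerivAt.1 (hF z)).continuousAt
  have hh : ∀ t, 0 ≤ t → HasDerivWithinAt (fun t => F (a t)) (‖P (G (a t))‖ ^ 2) (Set.Ici 0) t :=
    fun t ht => by
    have h := (hasGradientAt_iff_hasFDerivAt.1 (hF (a t))).comp_hasDerivWithinAt t (hd t ht)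
    refine h.congr_deriv ?_
    rw [InnerProductSpace.toDual_apply_apply, ← real_inner_self_eq_norm_sq,
      Submodule.inner_starProjection_left_eq_right, hP,
      Submodule.starProjection_eq_self_iff.2 (Submodule.starProjection_apply_mem _ _)]
  have hhd : ∀ t, 0 < t → HasDerivAt (fun t => F (a t)) (‖P (G (a t))‖ ^ 2) t := fun t ht =>
    (hh t ht.le).hasDerivAt (Ici_mem_nhds ht)
  have hhc : ContinuousOn (fun t => F (a t)) (Set.Ici 0) :=
    HasDerivWithinAt.continuousOn fun t ht => hh t ht
  have hmono : MonotoneOn (fun t => F (a t)) (Set.Ici 0) := by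
    refine monotoneOn_of_deriv_nonneg (convex_Ici 0) hhc ?_ ?_ <;> rw [interior_Ici]
    · exact fun t ht => (hhd t ht).differentiableAt.differentiableWithinAt
    · intro t ht
      rw [(hhd t ht).deriv]
      positivity
  have hmem : ∀ t, 0 ≤ t → a t ∈ {z | toLin A z = toLin A p ∧ F p ≤ F z} := fun t ht =>
    ⟨hA t ht, by simpa [ha0] using hmono Set.self_mem_Ici ht ht⟩
  obtain ⟨M, hM⟩ := hS.bddAbove_image hFc.continuousOn
  have hlim : ∃ l, Tendsto (fun t => F (a t)) atTop (𝓝 l) := by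
    have h1 : Monotone fun t => F (a (max t 0)) := fun s t hst =>
      hmono (le_max_right s 0) (le_max_right t 0) (max_le_max_right 0 hst)
    have h2 : BddAbove (Set.range fun t => F (a (max t 0))) := by
      refine ⟨M, ?_⟩
      rintro _ ⟨t, rfl⟩
      exact hM ⟨_, hmem _ (le_max_right t 0), rfl⟩
    refine ⟨_, (tendsto_atTop_ciSup h1 h2).congr' ?_⟩
    filter_upwards [eventually_ge_atTop 0] with t ht
    rw [max_eq_left ht]
  obtain ⟨l, hl⟩ := hlim
  -- The cost converges along the trajectory, so the mean value theorem on [k, k+1] supplies times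
  -- at which the projected gradient tends to 0. A cluster point at these times is critical, hence
  -- q.
  have hslope : ∀ k : ℕ, ∃ t ∈ Set.Ioo (k : ℝ) (k + 1),
      ‖P (G (a t))‖ ^ 2 = F (a (k + 1)) - F (a k) := fun k => by
    have hk : (0 : ℝ) ≤ k := k.cast_nonneg
    obtain ⟨t, ht, h⟩ := exists_hasDerivAt_eq_slope (fun t => F (a t))
      (fun t => ‖P (G (a t))‖ ^ 2) (lt_add_one (k : ℝ))
      (hhc.mono fun s hs => hk.trans hs.1) (fun s hs => hhd s (hk.trans_lt hs.1))
    exact ⟨t, ht, by simpa using h⟩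
  choose τ hτ hτs using hslope
  have hτ0 : ∀ k, 0 ≤ τ k := fun k => k.cast_nonneg.trans (hτ k).1.le
  have hτtop : Tendsto τ atTop atTop :=
    tendsto_atTop_mono (fun k => (hτ k).1.le) tendsto_natCast_atTop_atTop
  have hτlim : Tendsto (fun k => ‖P (G (a (τ k)))‖ ^ 2) atTop (𝓝 0) := by
    simp only [hτs]
    have h1 := hl.comp (tendsto_natCast_atTop_atTop (R := ℝ))
    have h2 := hl.comp (tendsto_atTop_add_const_right _ (1 : ℝ)
      (tendsto_natCast_atTop_atTop (R := ℝ)))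
    simpa using h2.sub h1
  obtain ⟨z, hz, φ, hφ, hφz⟩ := hS.tendsto_subseq fun k => hmem (τ k) (hτ0 k)
  have hzq : z = q := by
    refine hcrit z hz.1 hz.2 ?_
    have h1 : Tendsto (fun k => ‖P (G (a (τ (φ k))))‖ ^ 2) atTop (𝓝 (‖P (G z)‖ ^ 2)) :=
      ((((P.continuous.comp hG).norm.pow 2).tendsto z).comp hφz)
    have h2 := tendsto_nhds_unique h1 (hτlim.comp hφ.tendsto_atTop)
    simpa using h2
  subst hzq
  have hlz : F z = l := tendsto_nhds_unique ((hFc.tendsto z).comp hφz)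
    (hl.comp (hτtop.comp hφ.tendsto_atTop))
  -- Every other cluster point has the same limiting cost F q, so `hmax` identifies it with q.
  refine hS.tendsto_nhds_of_unique_mapClusterPt
    ((eventually_ge_atTop 0).mono hmem) fun w hw hwc => hmax w hw.1 ?_
  have h1 : MapClusterPt (F w) atTop (F ∘ a) := hwc.continuousAt_comp hFc.continuousAt
  have h2 : F w = l := eq_of_nhds_neBot (NeBot.mono h1 (inf_le_inf_left _ hl))
  rw [hlz, h2]

/-! ### Trajectories of the spline cost. -/

theorem exists_norm_costGrad_le {γ : ℝ} (hγ : 0 < γ) :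
    ∃ B : ℝ, ∀ z : EuclideanSpace ℝ (Fin m), ‖costGrad γ z‖ ≤ B := by
  refine ⟨√(m * 2 ^ 2), fun z => Real.le_sqrt_of_sq_le ?_⟩
  rw [EuclideanSpace.real_norm_sq_eq]
  refine (Finset.sum_le_card_nsmul _ _ (2 ^ 2) fun i _ => ?_).trans (by simp)
  rw [← sq_abs]
  exact pow_le_pow_left₀ (abs_nonneg _) (abs_splineDeriv_le hγ _) 2

theorem exists_lipschitzWith_costGrad (γ : ℝ) :
    ∃ C : NNReal, LipschitzWith C (costGrad γ : EuclideanSpace ℝ (Fin m) → _) := by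
  obtain ⟨C, hC⟩ := exists_lipschitzWith_splineDeriv γ
  refine ⟨C, LipschitzWith.of_dist_le_mul fun x y => ?_⟩
  rw [EuclideanSpace.dist_eq, EuclideanSpace.dist_eq]
  refine Real.sqrt_le_left ?_ |>.2 ?_
  · positivity
  · rw [mul_pow, Real.sq_sqrt (by positivity), Finset.mul_sum]
    refine Finset.sum_le_sum fun i _ => ?_
    rw [← mul_pow]
    exact pow_le_pow_left₀ dist_nonneg (hC.dist_le_mul _ _) 2

theorem exists_isSteepestAscent (A : Matrix (Fin n) (Fin m) ℝ) {γ : ℝ} (hγ : 0 < γ) (σ : ℝ)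
    (p : EuclideanSpace ℝ (Fin m)) : ∃ a, IsSteepestAscent A (cost γ σ) p a := by
  obtain ⟨B, hB⟩ := exists_norm_costGrad_le (m := m) hγ
  obtain ⟨C, hC⟩ := exists_lipschitzWith_costGrad (m := m) γ
  set P := (LinearMap.ker (toLin A)).starProjection with hP
  have h1 : LipschitzWith _ fun z : EuclideanSpace ℝ (Fin m) =>
      (σ⁻¹ • P) (costGrad γ ((σ⁻¹ • ContinuousLinearMap.id ℝ _) z)) :=
    (σ⁻¹ • P).lipschitz.comp (hC.comp (σ⁻¹ • ContinuousLinearMap.id ℝ _).lipschitz)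
  obtain ⟨a, ha0, ha⟩ := exists_integralCurve_Ici h1 (B := ‖σ⁻¹ • P‖₊ * B.toNNReal) (fun z => by
    refine ((σ⁻¹ • P).le_opNorm _).trans ?_
    rw [NNReal.coe_mul, coe_nnnorm]
    exact mul_le_mul_of_nonneg_left ((hB _).trans (Real.le_coe_toNNReal B)) (norm_nonneg _)) p
  refine ⟨a, ha0, fun t ht => (ha t ht).congr_deriv ?_⟩
  rw [(hasGradientAt_cost hγ σ (a t)).gradient]
  simp [hP]

theorem exists_isCrit_isMaxOn {K : Submodule ℝ (EuclideanSpace ℝ (Fin m))} {N : ℕ} {γ : ℝ}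
    (hK : NullSpaceProperty K N γ) (hγ : 0 < γ) {p : EuclideanSpace ℝ (Fin m)}
    (hp : m - N / (1 + γ) < cost γ 1 p) :
    ∃ q, q - p ∈ K ∧ IsCrit K γ q ∧ IsMaxOn (cost γ 1) {z | z - p ∈ K} q := by
  obtain ⟨q, hq, hmax⟩ := (isCompact_superlevel hK hγ hp p).exists_isMaxOn ⟨p, by simp, le_rfl⟩
    (continuous_cost hγ 1).continuousOn
  have hmax' : IsMaxOn (cost γ 1) {z | z - p ∈ K} q := fun z hz => by
    rcases le_total (cost γ 1 p) (cost γ 1 z) with h | h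
    · exact hmax ⟨hz, h⟩
    · exact h.trans hq.2
  refine ⟨q, hq.1, isCrit_of_eventually_le hγ (Eventually.of_forall fun w hw => hmax' ?_), hmax'⟩
  simpa using K.add_mem hw hq.1

/-- Started at a high level of the cost function, every steepest ascent trajectory converges to
the maximizer. -/
theorem exists_isMaxOn_tendsto {A : Matrix (Fin n) (Fin m) ℝ} {N : ℕ} {γ σ : ℝ}
    (hK : NullSpaceProperty (LinearMap.ker (toLin A)) N γ) (hγ : 0 < γ) (hσ : 0 < σ)
    {p : EuclideanSpace ℝ (Fin m)} (hp : m - N / (1 + γ) < cost γ σ p) :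
    ∃ q, toLin A q = toLin A p ∧ IsMaxOn (cost γ σ) {z | toLin A z = toLin A p} q ∧
      ∀ a, IsSteepestAscent A (cost γ σ) p a → Tendsto a atTop (𝓝 q) := by
  set K := LinearMap.ker (toLin A) with hKdef
  have hmem : ∀ z w, toLin A z = toLin A w ↔ σ⁻¹ • z - σ⁻¹ • w ∈ K := fun z w => by
    rw [← smul_sub, K.smul_mem_iff (inv_ne_zero hσ.ne'), hKdef, LinearMap.mem_ker, map_sub,
      sub_eq_zero]
  have hcost : ∀ z : EuclideanSpace ℝ (Fin m), cost γ σ z = cost γ 1 (σ⁻¹ • z) :=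
    cost_eq_cost_one γ σ
  rw [hcost] at hp
  obtain ⟨q, hq, hqc, hqm⟩ := exists_isCrit_isMaxOn hK hγ hp
  have hmax : IsMaxOn (cost γ σ) {z | toLin A z = toLin A p} (σ • q) := fun z hz => by
    have := hqm (a := σ⁻¹ • z) ((hmem z p).1 hz)
    rwa [Set.mem_ofPred_eq, hcost, hcost, inv_smul_smul₀ hσ.ne']
  have huniq : ∀ z, toLin A z = toLin A p → cost γ 1 (σ⁻¹ • p) ≤ cost γ 1 (σ⁻¹ • z) →
      IsCrit K γ (σ⁻¹ • z) → z = σ • q := fun z hz hc hzc => by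
    have h1 : σ⁻¹ • z - q ∈ K := by
      simpa using K.sub_mem ((hmem z p).1 hz) hq
    have h2 := hzc.eq_of_lt_cost hK hγ hqc h1 (hp.trans_le hc)
      (hp.trans_le (hqm (a := σ⁻¹ • p) (by simp)))
    rw [← h2, smul_inv_smul₀ hσ.ne']
  refine ⟨σ • q, (hmem _ _).2 (by rwa [inv_smul_smul₀ hσ.ne']), hmax, fun a ha => ?_⟩
  refine ha.tendsto (hasGradientAt_cost hγ σ)
    (((continuous_costGrad γ).comp (continuous_const_smul σ⁻¹)).const_smul σ⁻¹ :) ?_ ?_ ?_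
  · have e : {z | toLin A z = toLin A p ∧ cost γ σ p ≤ cost γ σ z} =
        (fun w => σ • w) '' {z | z - σ⁻¹ • p ∈ K ∧ cost γ 1 (σ⁻¹ • p) ≤ cost γ 1 z} := by
      ext z
      simp only [hcost, hmem, Set.mem_ofPred_eq, Set.mem_image]
      constructor
      · exact fun h => ⟨σ⁻¹ • z, h, smul_inv_smul₀ hσ.ne' z⟩
      · rintro ⟨w, hw, rfl⟩
        rwa [inv_smul_smul₀ hσ.ne']
    rw [e]
    exact (isCompact_superlevel hK hγ hp _).image (continuous_const_smul σ)
  · intro z hz hc hPz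
    rw [hcost, hcost] at hc
    refine huniq z hz hc fun v hv => ?_
    have h := (Submodule.mem_orthogonal' _ _).1
      ((Submodule.starProjection_apply_eq_zero_iff _).1 hPz) v hv
    rw [real_inner_smul_left] at h
    exact (mul_eq_zero.1 h).resolve_left (inv_ne_zero hσ.ne')
  · intro z hz hc
    have hge : ∀ w, toLin A w = toLin A p → cost γ σ w ≤ cost γ σ z := fun w hw =>
      (hmax hw).trans hc
    refine huniq z hz ?_ ?_
    · simpa only [hcost] using hge p rfl
    · refine isCrit_of_eventually_le hγ (Eventually.of_forall fun w hw => ?_)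
      have := hge (σ • w) (((hmem _ z).2 (by rwa [inv_smul_smul₀ hσ.ne'])).trans hz)
      rwa [hcost, hcost, inv_smul_smul₀ hσ.ne'] at this

end SL0

namespace SL0

/-! ### Restricted isometry and null space ratio -/

variable {n m : ℕ}

theorem norm_toLin_le (A : Matrix (Fin n) (Fin m) ℝ) (s : EuclideanSpace ℝ (Fin m)) :
    ‖toLin A s‖ ≤ ‖A‖ * ‖s‖ :=
  A.l2_opNorm_mulVec s

/-- If s is the part of v on I, then A s = -A(v - s), so (1-δ)‖s‖² ≤ ‖A‖²‖v - s‖². The hypothesis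
reads ‖A‖ ≤ α(1-δ); multiplying by α, using ‖A‖ ≤ 1 and cancelling one factor ‖A‖ leaves the claim.
-/
theorem nullSpaceProperty_of_lowerARIC {A : Matrix (Fin n) (Fin m) ℝ} (hA0 : A ≠ 0)
    (hA : ‖A‖ ≤ 1) {α : ℝ} (hα : 1 < α) {r : ℕ} (h : α * lowerARIC A r + ‖A‖ ≤ α) :
    NullSpaceProperty (LinearMap.ker (toLin A)) r α := by
  intro I hI v hv
  have hpos : 0 < ‖A‖ := norm_pos_iff.2 hA0
  set s : EuclideanSpace ℝ (Fin m) := WithLp.toLp 2 fun i => if i ∈ I then v i else 0 with hs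
  have hsI : ‖s‖ ^ 2 = ∑ i ∈ I, v i ^ 2 := by
    rw [EuclideanSpace.real_norm_sq_eq]
    simp [hs, ite_pow]
  have hsc : ‖v - s‖ ^ 2 = ∑ i ∈ Iᶜ, v i ^ 2 := by
    rw [EuclideanSpace.real_norm_sq_eq, ← Finset.sum_add_sum_compl I,
      Finset.sum_eq_zero fun i hi => by simp [hs, hi], zero_add]
    exact Finset.sum_congr rfl fun i hi => by simp [hs, Finset.mem_compl.1 hi]
  have hnnz : nnz s ≤ r := by
    refine (Finset.card_le_card fun i hi => ?_).trans hI
    by_contra hiI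
    simp [hs, hiI] at hi
  have h1 := (lowerARIC_isLeast A r).1.2 s hnnz
  have h2 : ‖toLin A s‖ ≤ ‖A‖ * ‖v - s‖ := by
    have h3 := norm_toLin_le A (v - s)
    rwa [map_sub, LinearMap.mem_ker.1 hv, zero_sub, norm_neg] at h3
  have h3 := pow_le_pow_left₀ (norm_nonneg _) h2 2
  rw [← hsI, ← hsc]
  have h4 : ‖A‖ * ‖s‖ ^ 2 ≤ ‖A‖ * (α * ‖v - s‖ ^ 2) := by
    calc ‖A‖ * ‖s‖ ^ 2 ≤ α * (1 - lowerARIC A r) * ‖s‖ ^ 2 :=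
          mul_le_mul_of_nonneg_right (by linarith) (sq_nonneg _)
      _ = α * ((1 - lowerARIC A r) * ‖s‖ ^ 2) := by ring
      _ ≤ α * (‖A‖ * ‖v - s‖) ^ 2 := mul_le_mul_of_nonneg_left (h1.trans h3) (by linarith)
      _ = ‖A‖ * (‖A‖ * (α * ‖v - s‖ ^ 2)) := by ring
      _ ≤ ‖A‖ * (α * ‖v - s‖ ^ 2) :=
          mul_le_mul_of_nonneg_left (mul_le_of_le_one_left (by positivity) hA) hpos.le
  exact le_of_mul_le_mul_left h4 hpos

theorem NullSpaceProperty.nullRatio_le {A : Matrix (Fin n) (Fin m) ℝ} {r : ℕ} {α : ℝ} (hα : 0 ≤ α)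
    (h : NullSpaceProperty (LinearMap.ker (toLin A)) r α) :
    nullRatio A r ≤ ENNReal.ofReal α := by
  refine iSup_le fun I => iSup_le fun hI => iSup_le fun s => iSup_le fun hs => iSup_le fun _ => ?_
  refine ENNReal.div_le_of_le_mul ?_
  rw [← ENNReal.ofReal_mul hα]
  exact ENNReal.ofReal_le_ofReal (h I hI s hs)

/-- If it is finite, the null space ratio is a null space constant. -/
theorem nullSpaceProperty_nullRatio {A : Matrix (Fin n) (Fin m) ℝ} {r : ℕ}
    (h : nullRatio A r ≠ ⊤) :
    NullSpaceProperty (LinearMap.ker (toLin A)) r (nullRatio A r).toReal := by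
  intro I hI v hv
  rcases eq_or_ne v 0 with rfl | hv0
  · simp
  have h1 : ENNReal.ofReal (∑ i ∈ I, v i ^ 2) / ENNReal.ofReal (∑ i ∈ Iᶜ, v i ^ 2) ≤
      nullRatio A r := by
    unfold nullRatio
    exact le_iSup_of_le I <| le_iSup_of_le hI <| le_iSup_of_le v <| le_iSup_of_le hv <|
      le_iSup_of_le hv0 le_rfl
  have hI0 : 0 ≤ ∑ i ∈ I, v i ^ 2 := Finset.sum_nonneg fun i _ => sq_nonneg _
  have hIc : 0 ≤ ∑ i ∈ Iᶜ, v i ^ 2 := Finset.sum_nonneg fun i _ => sq_nonneg _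
  rcases hIc.eq_or_lt with h0 | h0
  · rw [← h0, ENNReal.ofReal_zero] at h1
    rw [← h0, mul_zero]
    by_contra! h2
    rw [ENNReal.div_zero (ENNReal.ofReal_pos.2 h2).ne'] at h1
    exact h (top_le_iff.1 h1)
  · rw [ENNReal.div_le_iff (ENNReal.ofReal_pos.2 h0).ne' ENNReal.ofReal_ne_top,
      ← ENNReal.ofReal_toReal h, ← ENNReal.ofReal_mul ENNReal.toReal_nonneg] at h1
    exact (ENNReal.ofReal_le_ofReal_iff (by positivity)).1 h1

/-- Singletons already force γ > 0, which is what makes the spline continuously differentiable. -/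
theorem NullSpaceProperty.pos {K : Submodule ℝ (EuclideanSpace ℝ (Fin m))} {N : ℕ} {γ : ℝ}
    (hK : NullSpaceProperty K N γ) (hK0 : K ≠ ⊥) (hN : 0 < N) : 0 < γ := by
  by_contra! hγ
  obtain ⟨v, hv, hv0⟩ := Submodule.exists_mem_ne_zero_of_ne_bot hK0
  refine hv0 ?_
  ext i
  have h := hK {i} (by rw [Finset.card_singleton]; exact hN) v hv
  rw [Finset.sum_singleton] at h
  have h2 : γ * ∑ j ∈ {i}ᶜ, v j ^ 2 ≤ 0 :=
    mul_nonpos_of_nonpos_of_nonneg hγ (Finset.sum_nonneg fun i _ => sq_nonneg _)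
  simpa using le_antisymm (h.trans h2) (sq_nonneg _)

theorem ker_toLin_ne_bot (hnm : n < m) (A : Matrix (Fin n) (Fin m) ℝ) :
    LinearMap.ker (toLin A) ≠ ⊥ :=
  LinearMap.ker_ne_bot_of_finrank_lt (by simpa using hnm)

theorem toLin_minNormSol {A : Matrix (Fin n) (Fin m) ℝ} (hrows : LinearIndependent ℝ A.row)
    (x : EuclideanSpace ℝ (Fin n)) : toLin A (minNormSol A x) = x := by
  have h1 := (Matrix.PosDef.mul_conjTranspose_self A (Matrix.vecMul_injective_iff.2 hrows)).isUnit
  rw [Matrix.conjTranspose_eq_transpose_of_trivial, Matrix.isUnit_iff_isUnit_det] at h1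
  simp only [minNormSol, toLin, Matrix.toLpLin_apply, Matrix.mulVec_mulVec]
  rw [← Matrix.mul_assoc, Matrix.mul_nonsing_inv _ h1, Matrix.one_mulVec]

theorem card_union_support_le {s₀ : EuclideanSpace ℝ (Fin m)} {I : Finset (Fin m)} {k : ℕ}
    (hI : I.card ≤ k) (hs₀ : nnz s₀ = k) :
    (I ∪ Finset.univ.filter fun i => s₀ i ≠ 0).card ≤ 2 * k := by
  refine (Finset.card_union_le _ _).trans ?_
  have : (Finset.univ.filter fun i => s₀ i ≠ 0).card = k := hs₀
  omega

/-- Under a null space property of order `2k`, a `k`-sparse solution is the sparsest one. -/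
theorem NullSpaceProperty.lt_nnz {A : Matrix (Fin n) (Fin m) ℝ} {N k : ℕ} {γ : ℝ}
    (hK : NullSpaceProperty (LinearMap.ker (toLin A)) N γ) (hkN : 2 * k ≤ N) (hγ : 0 ≤ γ)
    {s s₀ : EuclideanSpace ℝ (Fin m)} (hs₀ : nnz s₀ = k) (hs : toLin A s = toLin A s₀)
    (hne : s ≠ s₀) : k < nnz s := by
  by_contra! h
  refine hne (sub_eq_zero.1 (norm_eq_zero.1 ?_))
  have hKs : s - s₀ ∈ LinearMap.ker (toLin A) := by rw [LinearMap.mem_ker, map_sub, hs, sub_self]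
  have h1 := norm_sub_sq_le hK hγ hKs ((card_union_support_le h hs₀).trans hkN) (C := 0)
    fun i hi => by
      simp only [Finset.mem_union, Finset.mem_filter, Finset.mem_univ, true_and, not_or,
        not_not] at hi
      simp [hi.1, hi.2]
  simpa using le_antisymm (h1.trans_eq (by simp)) (sq_nonneg _)

/-! ### Levels of the cost function -/

variable {γ σ : ℝ}

theorem card_sub_nnz_le_cost (hγ : 0 ≤ γ) (σ : ℝ) (s : EuclideanSpace ℝ (Fin m)) :
    m - nnz s ≤ cost γ σ s := by
  have h : ∑ i, (1 - if s i ≠ 0 then (1 : ℝ) else 0) ≤ cost γ σ s := by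
    refine Finset.sum_le_sum fun i _ => ?_
    split_ifs with hi
    · simpa using spline_nonneg hγ _
    · rw [not_not] at hi
      simp [hi, spline_zero]
  rw [Finset.sum_sub_distrib, Finset.sum_boole] at h
  simpa [nnz] using h

theorem sub_le_cost_of_norm_le (hγ : 0 < γ) (hσ : 0 < σ) {s : EuclideanSpace ℝ (Fin m)} {k : ℕ}
    (h : ‖s‖ ≤ σ * √(k * (1 + γ))) : m - k ≤ cost γ σ s := by
  have h1 : ∑ i, (1 - (s i / σ) ^ 2 / (1 + γ)) ≤ cost γ σ s :=
    Finset.sum_le_sum fun i _ => one_sub_le_spline hγ _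
  have h2 : ∑ i, (1 - (s i / σ) ^ 2 / (1 + γ)) = m - ‖s‖ ^ 2 / (σ ^ 2 * (1 + γ)) := by
    rw [Finset.sum_sub_distrib, EuclideanSpace.real_norm_sq_eq, Finset.sum_div]
    simp [div_pow, div_div]
  have h3 : ‖s‖ ^ 2 ≤ k * (σ ^ 2 * (1 + γ)) := by
    refine (pow_le_pow_left₀ (norm_nonneg _) h 2).trans_eq ?_
    rw [mul_pow, Real.sq_sqrt (by positivity)]
    ring
  have h4 := (div_le_iff₀ (by positivity : 0 < σ ^ 2 * (1 + γ))).2 h3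
  linarith

theorem cost_sub_le_cost_mul (hγ : 0 < γ) {c : ℝ} (hc : 0 < c) (hc1 : c ≤ 1)
    (s : EuclideanSpace ℝ (Fin m)) :
    cost γ σ s - m * (2 * (c⁻¹ - 1)) ≤ cost γ (σ * c) s := by
  have h : ∑ i, (spline γ (s i / σ) - 2 * (c⁻¹ - 1)) ≤ cost γ (σ * c) s := by
    refine Finset.sum_le_sum fun i _ => ?_
    have := spline_sub_le_spline_mul hγ ((one_le_inv₀ hc).2 hc1) (s i / σ)
    rwa [inv_mul_eq_div, div_div] at this
  simpa [cost, Finset.sum_sub_distrib] using h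

theorem card_gt_le (hγ : 0 ≤ γ) (hσ : 0 < σ) {s : EuclideanSpace ℝ (Fin m)} {k : ℕ}
    (h : m - k ≤ cost γ σ s) :
    (Finset.univ.filter fun i => (1 + γ) * σ < |s i|).card ≤ k := by
  have h1 : cost γ σ s ≤ ∑ i, (1 - if (1 + γ) * σ < |s i| then (1 : ℝ) else 0) := by
    refine Finset.sum_le_sum fun i _ => ?_
    split_ifs with hi
    · have h2 : 1 + γ < |s i / σ| := by
        rwa [abs_div, abs_of_pos hσ, lt_div_iff₀ hσ]
      rw [spline, if_neg (by linarith), if_neg (by linarith)]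
      simp
    · simpa using spline_le_one hγ _
  rw [Finset.sum_sub_distrib, Finset.sum_boole] at h1
  simp only [Finset.sum_const, Finset.card_univ, Fintype.card_fin, nsmul_eq_mul, mul_one] at h1
  have h2 := h.trans h1
  exact_mod_cast (sub_le_sub_iff_left (m : ℝ)).1 h2

/-- A solution with a large cost function at a small scale is close to the sparse solution. -/
theorem norm_sub_sq_le_of_le_cost {A : Matrix (Fin n) (Fin m) ℝ} {N k : ℕ}
    (hK : NullSpaceProperty (LinearMap.ker (toLin A)) N γ) (hkN : 2 * k ≤ N) (hγ : 0 ≤ γ)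
    (hσ : 0 < σ) {s s₀ : EuclideanSpace ℝ (Fin m)} (hs₀ : nnz s₀ = k)
    (hs : toLin A s = toLin A s₀) (h : m - k ≤ cost γ σ s) :
    ‖s - s₀‖ ^ 2 ≤ (1 + γ) * (m * ((1 + γ) * σ) ^ 2) := by
  have hKs : s - s₀ ∈ LinearMap.ker (toLin A) := by rw [LinearMap.mem_ker, map_sub, hs, sub_self]
  refine norm_sub_sq_le hK hγ hKs
    ((card_union_support_le (card_gt_le hγ hσ h) hs₀).trans hkN) fun i hi => ?_
  simp only [Finset.mem_union, Finset.mem_filter, Finset.mem_univ, true_and, not_or,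
    not_not, not_lt] at hi
  simpa [hi.2] using hi.1

/-! ### The zero solution -/

theorem cost_smul_le (hγ : 0 ≤ γ) (σ : ℝ) (z : EuclideanSpace ℝ (Fin m)) {s t : ℝ} (hs : 0 ≤ s)
    (hst : s ≤ t) : cost γ σ (t • z) ≤ cost γ σ (s • z) := by
  refine Finset.sum_le_sum fun i _ => spline_le_spline hγ ?_
  simp only [PiLp.smul_apply, smul_eq_mul, abs_div, abs_mul, abs_of_nonneg hs,
    abs_of_nonneg (hs.trans hst)]
  gcongr

/-- The cost decreases along rays from 0. At γ = 0 the spline has kinks; there `gradient` takes its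
default value 0, which also satisfies the bound. -/
theorem inner_gradient_cost_nonpos (hγ : 0 ≤ γ) (σ : ℝ) (z : EuclideanSpace ℝ (Fin m)) :
    inner ℝ (gradient (cost γ σ) z) z ≤ 0 := by
  by_cases h : DifferentiableAt ℝ (cost γ σ) z
  -- The exponential keeps the scale positive, so the cost is antitone along the whole curve, whose
  -- velocity at 0 is z.
  · have h1 : HasDerivAt (fun t : ℝ => Real.exp t • z) z 0 := by
      simpa using (Real.hasDerivAt_exp 0).smul_const z
    have h2 : HasFDerivAt (cost γ σ)
        (InnerProductSpace.toDual ℝ _ (gradient (cost γ σ) z)) (Real.exp 0 • z) := by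
      rw [Real.exp_zero, one_smul]
      exact hasGradientAt_iff_hasFDerivAt.1 h.hasGradientAt
    have hanti : Antitone (cost γ σ ∘ fun t : ℝ => Real.exp t • z) := fun s t hst =>
      cost_smul_le hγ σ z (Real.exp_pos s).le (Real.exp_le_exp.2 hst)
    have h3 := (h2.comp_hasDerivAt (0 : ℝ) h1).neg.nonneg_of_monotone hanti.neg
    simpa using h3
  · simp [gradient, fderiv_zero_of_not_differentiableAt h]

theorem cost_zero (γ σ : ℝ) : cost γ σ (0 : EuclideanSpace ℝ (Fin m)) = m := by
  simp [cost, spline_zero]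

theorem isSteepestAscent_zero (A : Matrix (Fin n) (Fin m) ℝ) (hγ : 0 ≤ γ) (σ : ℝ) :
    IsSteepestAscent A (cost γ σ) 0 fun _ => 0 := by
  refine ⟨rfl, fun t _ =>
    (hasDerivWithinAt_const t _ (0 : EuclideanSpace ℝ (Fin m))).congr_deriv ?_⟩
  have h : IsLocalMax (cost γ σ) (0 : EuclideanSpace ℝ (Fin m)) :=
    Eventually.of_forall fun z => by rw [cost_zero]; exact cost_le_card hγ σ z
  simp [gradient, h.fderiv_eq_zero]

/-- No uniqueness theorem for the flow is available at γ = 0. Instead ‖a‖² is nonincreasing: a stays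
in the null space, so the projection drops out of the inner product with a. -/
theorem IsSteepestAscent.eq_zero {A : Matrix (Fin n) (Fin m) ℝ} (hγ : 0 ≤ γ)
    {a : ℝ → EuclideanSpace ℝ (Fin m)} (ha : IsSteepestAscent A (cost γ σ) 0 a) {t : ℝ}
    (ht : 0 ≤ t) : a t = 0 := by
  have hd : ∀ s ∈ Set.Ici (0 : ℝ), HasDerivWithinAt (fun s => ‖a s‖ ^ 2) _ (Set.Ici 0) s :=
    fun s hs => (ha.2 s hs).norm_sq
  have h : AntitoneOn (fun s => ‖a s‖ ^ 2) (Set.Ici 0) := by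
    have hd' : ∀ s ∈ Set.Ioi (0 : ℝ), HasDerivAt (fun s => ‖a s‖ ^ 2) _ s :=
      fun s hs => (hd s (Set.Ioi_subset_Ici_self hs)).hasDerivAt (Ici_mem_nhds hs)
    refine antitoneOn_of_deriv_nonpos (convex_Ici 0) (HasDerivWithinAt.continuousOn hd) ?_ ?_ <;>
      rw [interior_Ici]
    · exact fun s hs => (hd' s hs).differentiableAt.differentiableWithinAt
    · intro s hs
      rw [(hd' s hs).deriv, ← Submodule.inner_starProjection_left_eq_right,
        Submodule.starProjection_eq_self_iff.2, real_inner_comm]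
      · exact mul_nonpos_of_nonneg_of_nonpos zero_le_two (inner_gradient_cost_nonpos hγ σ _)
      · rw [LinearMap.mem_ker, ha.toLin_eq (Set.Ioi_subset_Ici_self hs), map_zero]
  have h1 := h Set.self_mem_Ici ht ht
  simp only [ha.1, norm_zero] at h1
  simpa using le_antisymm (h1.trans_eq (by simp)) (sq_nonneg _)

end SL0

namespace SL0

/-! ### Convergence of asymptotic SL0 -/

variable {n m : ℕ} {γ : ℝ}

/-- For the zero measurement, asymptotic SL0 stays at zero. -/
theorem isAsymptoticSL0_zero (A : Matrix (Fin n) (Fin m) ℝ) (hγ : 0 ≤ γ) (σ : ℕ → ℝ) :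
    IsAsymptoticSL0 A 0 γ σ fun _ => 0 := by
  refine ⟨by simp [minNormSol], fun j => ⟨⟨_, isSteepestAscent_zero A hγ _⟩, fun a ha => ?_⟩⟩
  refine tendsto_const_nhds.congr' ?_
  filter_upwards [eventually_ge_atTop 0] with t ht
  exact (ha.eq_zero hγ ht).symm

/-- Asymptotic SL0 converges to the sparse solution if the scales decrease so slowly that the
cost function never falls below the level that forces a unique critical point. -/
theorem exists_isAsymptoticSL0_tendsto {A : Matrix (Fin n) (Fin m) ℝ}
    (hrows : LinearIndependent ℝ A.row) {N k : ℕ}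
    (hK : NullSpaceProperty (LinearMap.ker (toLin A)) N γ) (hγ : 0 < γ) (hkN : 2 * k ≤ N)
    {c : ℝ} (hc0 : 0 < c) (hc1 : c < 1) (hc : m * (2 * (c⁻¹ - 1)) < N / (1 + γ) - k)
    {s₀ : EuclideanSpace ℝ (Fin m)} (hs₀ : nnz s₀ = k) {σ₁ : ℝ} (hσ₁ : 0 < σ₁)
    (hstart : ‖minNormSol A (toLin A s₀)‖ ≤ σ₁ * √(k * (1 + γ))) :
    ∃ s : ℕ → EuclideanSpace ℝ (Fin m),
      IsAsymptoticSL0 A (toLin A s₀) γ (fun j => σ₁ * c ^ j) s ∧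
      (∀ j : ℕ, IsMaxOn (cost γ (σ₁ * c ^ (j + 1))) {z | toLin A z = toLin A s₀} (s (j + 1))) ∧
      Tendsto s atTop (𝓝 s₀) := by
  have hσ : ∀ j : ℕ, 0 < σ₁ * c ^ j := fun j => by positivity
  have hlevel : ∀ σ : ℝ, (m : ℝ) - k ≤ cost γ σ s₀ := fun σ => by
    rw [← hs₀]; exact card_sub_nnz_le_cost hγ.le σ s₀
  have hstep : ∀ (j : ℕ) (p : EuclideanSpace ℝ (Fin m)), ∃ q,
      toLin A p = toLin A s₀ → m - k ≤ cost γ (σ₁ * c ^ j) p →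
      toLin A q = toLin A s₀ ∧
      IsMaxOn (cost γ (σ₁ * c ^ (j + 1))) {z | toLin A z = toLin A s₀} q ∧
      ∀ a, IsSteepestAscent A (cost γ (σ₁ * c ^ (j + 1))) p a → Tendsto a atTop (𝓝 q) :=
    fun j p => by
    by_cases h : toLin A p = toLin A s₀ ∧ m - k ≤ cost γ (σ₁ * c ^ j) p
    · have h1 := cost_sub_le_cost_mul (σ := σ₁ * c ^ j) hγ hc0 hc1.le p
      rw [mul_assoc, ← pow_succ] at h1
      obtain ⟨q, hq⟩ := exists_isMaxOn_tendsto hK hγ (hσ (j + 1)) (p := p) (by linarith [h.2])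
      rw [h.1] at hq
      exact ⟨q, fun _ _ => hq⟩
    -- An arbitrary value where the hypotheses fail, so that `next` is a total function and the
    -- iterates can be defined by recursion before the invariant is known.
    · exact ⟨0, fun h1 h2 => absurd ⟨h1, h2⟩ h⟩
  choose next hnext using hstep
  set s : ℕ → EuclideanSpace ℝ (Fin m) := fun j =>
    Nat.rec (minNormSol A (toLin A s₀)) (fun i p => next i p) j with hs
  have hinv : ∀ j, toLin A (s j) = toLin A s₀ ∧ m - k ≤ cost γ (σ₁ * c ^ j) (s j) := fun j => by
    induction j with
    | zero =>
      refine ⟨toLin_minNormSol hrows _, ?_⟩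
      rw [pow_zero, mul_one]
      exact sub_le_cost_of_norm_le hγ hσ₁ hstart
    | succ j ih =>
      obtain ⟨h1, h2, -⟩ := hnext j (s j) ih.1 ih.2
      -- The new iterate maximizes at the new scale, so it inherits the level m - k from s₀: losses
      -- do not accumulate over the steps.
      exact ⟨h1, (hlevel _).trans (h2 (a := s₀) rfl)⟩
  have hsucc := fun j => hnext j (s j) (hinv j).1 (hinv j).2
  refine ⟨s, ⟨rfl, fun j => ⟨exists_isSteepestAscent A hγ _ _, (hsucc j).2.2⟩⟩,
    fun j => (hsucc j).2.1, ?_⟩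
  rw [tendsto_iff_norm_sub_tendsto_zero]
  have hpow : Tendsto (fun j : ℕ => c ^ j) atTop (𝓝 0) :=
    tendsto_pow_atTop_nhds_zero_of_lt_one hc0.le hc1
  have hbound : Tendsto (fun j : ℕ => √((1 + γ) * (m * ((1 + γ) * (σ₁ * c ^ j)) ^ 2)))
      atTop (𝓝 0) := by
    have hcont : Continuous fun u : ℝ => √((1 + γ) * (m * ((1 + γ) * (σ₁ * u)) ^ 2)) := by fun_prop
    simpa [Function.comp_def] using (hcont.tendsto 0).comp hpow
  exact squeeze_zero (fun _ => norm_nonneg _) (fun j => Real.le_sqrt_of_sq_le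
    (norm_sub_sq_le_of_le_cost hK hkN hγ.le (hσ j) hs₀ (hinv j).1 (hinv j).2)) hbound

/-- Scale factors that are close enough to `1`. -/
theorem mul_inv_sub_one_le {M η c : ℝ} (hM : 0 < M) (hη : 0 ≤ η)
    (hc : 2 * M / (2 * M + η) ≤ c) : M * (2 * (c⁻¹ - 1)) ≤ η := by
  have h1 : 0 < 2 * M / (2 * M + η) := by positivity
  have h2 := inv_anti₀ h1 hc
  rw [inv_div, le_div_iff₀ (by positivity)] at h2
  linarith

end SL0

end

theorem mainTheorem2 {n m : ℕ} (hn : 0 < n) (hnm : n < m)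
    (A : Matrix (Fin n) (Fin m) ℝ) (hrows : LinearIndependent ℝ A.row) (hA : ‖A‖ ≤ 1)
    (α : ℝ) (hα : 1 < α) (k n₀ : ℕ) (hn₀ : n₀ = ⌈2 * (k : ℝ) * α⌉₊)
    (hARIP : α * SL0.lowerARIC A n₀ + ‖A‖ ≤ α)
    (γ : ℝ) (hγ : γ = (SL0.nullRatio A n₀).toReal) :
    SL0.nullRatio A n₀ ≠ ⊤ ∧
    ∃ c₀ : ℝ, 0 < c₀ ∧ c₀ < 1 ∧
      ((k : ℝ) < n₀ / (2 + 2 * γ) → c₀ ≤ 2 * m / (2 * m + n₀ / (2 + 2 * γ) - k)) ∧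
      ∀ (x : EuclideanSpace ℝ (Fin n)) (s₀ : EuclideanSpace ℝ (Fin m)),
        SL0.toLin A s₀ = x → SL0.nnz s₀ = k →
        (∀ s, SL0.toLin A s = x → s ≠ s₀ → k < SL0.nnz s) ∧
        ∀ c : ℝ, c₀ ≤ c → c < 1 →
        ∀ σ₁ : ℝ, 0 < σ₁ → ‖SL0.minNormSol A x‖ ≤ σ₁ * √(k * (1 + γ)) →
          ∃ s : ℕ → EuclideanSpace ℝ (Fin m),
            SL0.IsAsymptoticSL0 A x γ (fun j => σ₁ * c ^ j) s ∧
            (∀ j : ℕ, IsMaxOn (SL0.cost γ (σ₁ * c ^ (j + 1)))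
              {z | SL0.toLin A z = x} (s (j + 1))) ∧
            Tendsto s atTop (𝓝 s₀) := by
  have hA0 : A ≠ 0 := by
    rintro rfl
    exact hrows.ne_zero ⟨0, hn⟩ rfl
  have hle := (SL0.nullSpaceProperty_of_lowerARIC hA0 hA hα hARIP).nullRatio_le (by linarith)
  have hfin : SL0.nullRatio A n₀ ≠ ⊤ := ne_top_of_le_ne_top ENNReal.ofReal_ne_top hle
  have hγα : γ ≤ α := hγ ▸ ENNReal.toReal_le_of_le_ofReal (by linarith) hle
  have hγ0 : 0 ≤ γ := hγ ▸ ENNReal.toReal_nonneg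
  have hK : SL0.NullSpaceProperty (LinearMap.ker (SL0.toLin A)) n₀ γ :=
    hγ ▸ SL0.nullSpaceProperty_nullRatio hfin
  have hceil : 2 * (k : ℝ) * α ≤ n₀ := hn₀ ▸ Nat.le_ceil _
  have hkN : 2 * k ≤ n₀ := by
    have : (2 * k : ℝ) ≤ n₀ := le_trans (le_mul_of_one_le_right (by positivity) hα.le) hceil
    exact_mod_cast this
  have hmpos : (0 : ℝ) < m := by exact_mod_cast hn.trans hnm
  have hsparsest : ∀ (x : EuclideanSpace ℝ (Fin n)) (s₀ : EuclideanSpace ℝ (Fin m)),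
      SL0.toLin A s₀ = x → SL0.nnz s₀ = k →
      ∀ s, SL0.toLin A s = x → s ≠ s₀ → k < SL0.nnz s := by
    rintro _ s₀ rfl hs₀ s hs hne
    exact hK.lt_nnz hkN hγ0 hs₀ hs hne
  refine ⟨hfin, ?_⟩
  -- For k = 0 also n₀ = 0 and γ = 0, so the smooth theory does not apply; but then s₀ = 0 and the
  -- algorithm never leaves 0. Any c₀ in (0, 1) works.
  rcases Nat.eq_zero_or_pos k with hk | hk
  · refine ⟨1 / 2, by norm_num, by norm_num, ?_, fun x s₀ hx hs₀ => ⟨hsparsest x s₀ hx hs₀, ?_⟩⟩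
    · simp [hn₀, hk]
    · intro c _ _ σ₁ _ _
      have h0 : s₀ = 0 := by
        rw [hk, SL0.nnz, Finset.card_eq_zero] at hs₀
        ext i
        simpa using Finset.filter_eq_empty_iff.1 hs₀ (Finset.mem_univ i)
      subst h0
      rw [map_zero] at hx
      subst hx
      refine ⟨fun _ => 0, SL0.isAsymptoticSL0_zero A hγ0 _, fun j z _ => ?_, tendsto_const_nhds⟩
      rw [Set.mem_ofPred_eq, SL0.cost_zero]
      exact SL0.cost_le_card hγ0 _ z
  · have hkr : (0 : ℝ) < k := by exact_mod_cast hk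
    have hγpos : 0 < γ := hK.pos (SL0.ker_toLin_ne_bot hnm A) (by omega)
    have hgap : 0 < n₀ / (1 + γ) - k := by
      rw [sub_pos, lt_div_iff₀ (by positivity)]
      nlinarith
    have hhalf : (n₀ : ℝ) / (2 + 2 * γ) = n₀ / (1 + γ) / 2 := by
      rw [div_div]; congr 1; ring
    -- This c₀ lets one scale change use half of the gap n₀/(1+γ) - k. That half is at least
    -- n₀/(2+2γ) - k, which gives the asserted bound on c₀.
    refine ⟨2 * m / (2 * m + (n₀ / (1 + γ) - k) / 2), by positivity, ?_, fun h => ?_,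
      fun x s₀ hx hs₀ => ⟨hsparsest x s₀ hx hs₀, fun c hc hc1 σ₁ hσ₁ hstart => ?_⟩⟩
    · rw [div_lt_one (by positivity)]; linarith
    · rw [hhalf] at h ⊢
      exact div_le_div_of_nonneg_left (by positivity) (by linarith) (by linarith)
    · subst hx
      refine SL0.exists_isAsymptoticSL0_tendsto hrows hK hγpos hkN
        (lt_of_lt_of_le (by positivity) hc) hc1 ?_ hs₀ hσ₁ hstart
      exact (SL0.mul_inv_sub_one_le hmpos (half_pos hgap).le hc).trans_lt (half_lt_self hgap)
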